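/- **Criterion for Orlicz–Sobolev inequalities.** *Definitions.* A Young function is a convex even function $\Phi:\mathbb R\to[0,\infty]$ with $\Phi(0)=0$ and $\lim_{x\to+\infty}\Phi(x)=+\infty$. For a probability measure $\mu$ and a measurable real function $f$, let $$\|f\|_\Phi=\inf\Big\{\lambda>0:\int\Phi(f/\lambda)\,d\mu\le 1\Big\}\in[0,\infty]\qquad(\inf\emptyset=\infty)$$ be the Luxemburg norm, let $L_\Phi(\mu)$ be the set of measurable $f$ such that $\int\Phi(\alpha f)\,d\mu<\infty$ for some $\alpha>0$, and write $\mu(f)=\int f\,d\mu$. For probability measures $\mu,\nu$ on $\mathbb R^n$ that are absolutely continuous with respect to Lebesgue measure, and a Borel set $A\subset\mathbb R^n$ with $\mu(A)<\frac12$, let $$\mathrm{Cap}_\nu(A,\mu)=\inf\Big\{\int|\nabla f|^2\,d\nu:\ f:\mathbb R^n\to\mathbb R\text{ locally Lipschitz},\ \mathbf 1_A\le f\le \mathbf 1,\ \mu(f=0)\ge\tfrac12\Big\}.$$ *Theorem.* Let $\mu$ and $\nu(dx)=\rho_\nu(x)\,dx$ be absolutely continuous probability measures on $\mathbb R^n$.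 Let $\Phi$ be a Young function and let $k\in(0,\infty)$ be such that $\|\mu(f)^2\|_\Phi\le k\,\|f^2\|_\Phi$ for every measurable $f$ with $f^2\in L_\Phi(\mu)$. Let $C_\Phi\in[0,\infty]$ be the infimum of the constants $C\in[0,\infty)$ such that $$\|(f-\mu(f))^2\|_\Phi\le C\int|\nabla f|^2\,d\nu$$ for every smooth ($C^\infty$) $\mu$-integrable function $f:\mathbb R^n\to\mathbb R$, and let $B(\Phi)\in[0,\infty]$ be the infimum of the constants $B\in[0,\infty)$ such that $\|\mathbf 1_A\|_\Phi\le B\,\mathrm{Cap}_\nu(A,\mu)$ for every Borel set $A\subset\mathbb R^n$ with $\mu(A)<\frac12$ (an infimum over the empty set is $\infty$). Then $$\tfrac18 B(\Phi)\le C_\Phi\le 8(1+k)\,B(\Phi).$$ Moreover, if $n=1$ and $m$ is any median of $\mu$ (that is, $\mu((-\infty,m])\ge\frac12$ and $\mu([m,\infty))\ge\frac12$), then $$\tfrac18\max(B_+(\Phi),B_-(\Phi))\le C_\Phi\le 8(1+k)\max(B_+(\Phi),B_-(\Phi)),$$ where $$B_+(\Phi)=\sup_{x>m}\|\mathbf 1_{[x,\infty)}\|_\Phi\int_m^x\frac{1}{\rho_\nu(t)}\,dt,\qquad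 B_-(\Phi)=\sup_{x<m}\|\mathbf 1_{(-\infty,x]}\|_\Phi\int_x^m\frac{1}{\rho_\nu(t)}\,dt,$$ with the conventions $1/0=\infty$ and $0\cdot\infty=0$. -/

import Mathlib

open MeasureTheory
open scoped NNReal ENNReal ContDiff

noncomputable section

/-- Young functions: convex even functions `Φ : ℝ → [0, ∞]` with `Φ 0 = 0` and `Φ x → ∞` as
`x → +∞`. The value `∞` is allowed and no lower semicontinuity is required. -/
structure IsYoung (Φ : ℝ → ℝ≥0∞) : Prop where
  convex : ConvexOn ℝ≥0 Set.univ Φ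
  even : ∀ x, Φ (-x) = Φ x
  map_zero : Φ 0 = 0
  tendsto : Filter.Tendsto Φ Filter.atTop (nhds ⊤)

/-- Membership in the Orlicz space `L_Φ(μ)`. -/
def MemOrlicz {X : Type*} [MeasurableSpace X] (Φ : ℝ → ℝ≥0∞) (μ : Measure X) (f : X → ℝ) : Prop :=
  Measurable f ∧ ∃ a : ℝ, 0 < a ∧ ∫⁻ x, Φ (a * f x) ∂μ < ⊤

/-- The Luxemburg norm `‖f‖_Φ = inf {r > 0 : ∫ Φ(f / r) dμ ≤ 1}`, equal to `∞` when there is no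
such `r`. -/
def luxNorm {X : Type*} [MeasurableSpace X] (Φ : ℝ → ℝ≥0∞) (μ : Measure X) (f : X → ℝ) : ℝ≥0∞ :=
  ⨅ (r : ℝ≥0) (_ : 0 < r) (_ : ∫⁻ x, Φ (f x / r) ∂μ ≤ 1), (r : ℝ≥0∞)

/-- The Luxemburg norm `‖1_A‖_Φ` of an indicator function. -/
def luxInd {X : Type*} [MeasurableSpace X] (Φ : ℝ → ℝ≥0∞) (μ : Measure X) (A : Set X) : ℝ≥0∞ :=
  luxNorm Φ μ (A.indicator fun _ => (1 : ℝ))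

/-- The condition `‖μ(f)²‖_Φ ≤ k ‖f²‖_Φ` for all measurable `f` with `f² ∈ L_Φ(μ)`. -/
def MeanSqBound {X : Type*} [MeasurableSpace X] (Φ : ℝ → ℝ≥0∞) (μ : Measure X) (k : ℝ≥0) : Prop :=
  ∀ f : X → ℝ, Measurable f → MemOrlicz Φ μ (fun x => f x ^ 2) →
    luxNorm Φ μ (fun _ => (∫ y, f y ∂μ) ^ 2) ≤ k * luxNorm Φ μ (fun x => f x ^ 2)

section Euclidean

variable {E : Type*} [NormedAddCommGroup E] [InnerProductSpace ℝ E] [CompleteSpace E]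
  [MeasurableSpace E]

/-- The energy `∫ |∇f|² dν`, with values in `[0, ∞]`. -/
def energy (ν : Measure E) (f : E → ℝ) : ℝ≥0∞ :=
  ∫⁻ x, ‖gradient f x‖ₑ ^ 2 ∂ν

/-- The capacity `Cap_ν(A, μ)`: the infimum of the energies of the locally Lipschitz functions `f`
with `1_A ≤ f ≤ 1` and `μ(f = 0) ≥ 1/2`. -/
def capacity (ν μ : Measure E) (A : Set E) : ℝ≥0∞ :=
  ⨅ (f : E → ℝ) (_ : LocallyLipschitz f)
    (_ : ∀ x, A.indicator (fun _ => (1 : ℝ)) x ≤ f x ∧ f x ≤ 1)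
    (_ : 1 / 2 ≤ μ {x | f x = 0}), energy ν f

/-- The optimal constant `C_Φ ∈ [0, ∞]` in `‖(f - μ(f))²‖_Φ ≤ C ∫ |∇f|² dν` for smooth
`f : E → ℝ` (with `f` integrable, so that `μ(f)` makes sense). -/
def osConst (Φ : ℝ → ℝ≥0∞) (μ ν : Measure E) : ℝ≥0∞ :=
  ⨅ (C : ℝ≥0) (_ : ∀ f : E → ℝ, ContDiff ℝ ∞ f → Integrable f μ →
      luxNorm Φ μ (fun x => (f x - ∫ y, f y ∂μ) ^ 2) ≤ C * energy ν f), (C : ℝ≥0∞)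

/-- The best constant `B(Φ) ∈ [0, ∞]` in `‖1_A‖_Φ ≤ B Cap_ν(A, μ)` for Borel sets `A` with
`μ(A) < 1/2`. -/
def capConst (Φ : ℝ → ℝ≥0∞) (μ ν : Measure E) : ℝ≥0∞ :=
  ⨅ (B : ℝ≥0) (_ : ∀ A : Set E, MeasurableSet A → μ A < 1 / 2 →
      luxInd Φ μ A ≤ B * capacity ν μ A), (B : ℝ≥0∞)

end Euclidean

/-- `m` is a median of the probability measure `μ` on the line. -/
def IsMedian (μ : Measure ℝ) (m : ℝ) : Prop :=
  1 / 2 ≤ μ (Set.Iic m) ∧ 1 / 2 ≤ μ (Set.Ici m)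

/-- `B₊(Φ) = sup_{x > m} ‖1_{[x, ∞)}‖_Φ ∫_m^x 1/ρ`, in `[0, ∞]` with `1/0 = ∞`, `0 * ∞ = 0`. -/
def muckPlus (Φ : ℝ → ℝ≥0∞) (μ : Measure ℝ) (ρ : ℝ → ℝ≥0∞) (m : ℝ) : ℝ≥0∞ :=
  ⨆ (x : ℝ) (_ : m < x), luxInd Φ μ (Set.Ici x) * ∫⁻ y in Set.Icc m x, (ρ y)⁻¹

/-- `B₋(Φ) = sup_{x < m} ‖1_{(-∞, x]}‖_Φ ∫_x^m 1/ρ`, in `[0, ∞]` with `1/0 = ∞`, `0 * ∞ = 0`. -/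
def muckMinus (Φ : ℝ → ℝ≥0∞) (μ : Measure ℝ) (ρ : ℝ → ℝ≥0∞) (m : ℝ) : ℝ≥0∞ :=
  ⨆ (x : ℝ) (_ : x < m), luxInd Φ μ (Set.Iic x) * ∫⁻ y in Set.Icc x m, (ρ y)⁻¹

end

/-! Upper bounds. Since `f - μ(f) = (f - m) - μ(f - m)`, the inequality `(a - b)² ≤ 2(a² + b²)` and
the hypothesis on `k` reduce centering at the mean to centering at any point `m`, at the cost of a
factor `2(1 + k)` (`luxNorm_sub_mean_sq_le`). The remaining factor 4 is a strong-type capacitary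
estimate (`luxNorm_sq_le_of_luxInd_le`). For `m` a median of `f` and `F = (f - m)₊`, the function
`min((F/t)², 1)` is admissible for the capacity of `{F > t}`, and its energy is at most the integral
of `4F²/t⁴ |∇f|²` over `{0 < F ≤ t}`. Writing `F²` as the integral of `2t 1_{F > t} dt` and using
that the integral of `2t · 4F²/t⁴` over `t ≥ F` equals 4, one gets `‖F²‖ ≤ 4B ∫_{F > 0} |∇f|² dν`.
The `t`-integral is replaced by finite sums over geometric levels of ratio `q → 1`, so only the
triangle inequality and a Fatou property of the norm are needed. The parts `(f - m)₊` and `(f - m)₋`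
have disjoint supports, so their energies add up without loss.

Lower bounds. An admissible `g` vanishes on half of the space, so its mean is at most 1/2 and `(g -
μ(g))² ≥ 1/4` on `A`. The inequality is known only for smooth functions: a radial cutoff makes `g`
Lipschitz, mollification makes it smooth, and the uniform error of the mollification is absorbed by
replacing 4 with 8 (`luxInd_le_energy`).

On the line, the capacity is not used. For the upper bound `|f - f(m)|` is replaced by the monotone
function `∫_m^y |f'|`, whose superlevel sets lie in half-lines; Cauchy–Schwarz with weight `ρ`
supplies the hypothesis of the same capacitary estimate. For the lower bound the test functions are
normalised primitives of `min(1/ρ, N)` on `[m, x]`. The left half-line follows by reflection. -/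

namespace IsYoung

variable {Φ : ℝ → ℝ≥0∞}

theorem apply_abs (hΦ : IsYoung Φ) (x : ℝ) : Φ |x| = Φ x := by
  rcases abs_choice x with h | h <;> rw [h]
  exact hΦ.even x

theorem apply_mul_le (hΦ : IsYoung Φ) {a : ℝ≥0} (ha : a ≤ 1) (x : ℝ) :
    Φ (a * x) ≤ a * Φ x := by
  have h := hΦ.convex.2 (Set.mem_univ x) (Set.mem_univ 0) (zero_le (a := a))
    (zero_le (a := 1 - a)) (add_tsub_cancel_of_le ha)
  simpa [hΦ.map_zero, NNReal.smul_def, ENNReal.smul_def] using h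

theorem mono_of_nonneg (hΦ : IsYoung Φ) {x y : ℝ} (hx : 0 ≤ x) (hxy : x ≤ y) : Φ x ≤ Φ y := by
  rcases hx.eq_or_lt with rfl | hx'
  · simp [hΦ.map_zero]
  have hy : 0 < y := hx'.trans_le hxy
  obtain ⟨a, ha⟩ : ∃ a : ℝ≥0, (a : ℝ) = x / y := ⟨⟨x / y, by positivity⟩, rfl⟩
  have ha1 : a ≤ 1 := by
    rw [← NNReal.coe_le_coe, ha]
    exact (div_le_one hy).2 hxy
  have h := hΦ.apply_mul_le ha1 y
  rw [ha, div_mul_cancel₀ x hy.ne'] at h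
  refine h.trans (mul_le_of_le_one_left' ?_)
  exact_mod_cast ha1

theorem mono_abs (hΦ : IsYoung Φ) {x y : ℝ} (hxy : |x| ≤ |y|) : Φ x ≤ Φ y := by
  rw [← hΦ.apply_abs x, ← hΦ.apply_abs y]
  exact hΦ.mono_of_nonneg (abs_nonneg x) hxy

theorem measurable (hΦ : IsYoung Φ) : Measurable Φ := by
  have h1 : Monotone fun x => Φ (max x 0) := fun x y hxy =>
    hΦ.mono_of_nonneg (le_max_right _ _) (max_le_max_right 0 hxy)
  have h2 : Φ = fun x => Φ (max |x| 0) := by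
    funext x
    rw [max_eq_left (abs_nonneg x), hΦ.apply_abs]
  rw [h2]
  exact h1.measurable.comp measurable_abs

end IsYoung

/-! ### Luxemburg norm: triangle inequality, homogeneity, Fatou property. -/

section LuxNorm

variable {X : Type*} [MeasurableSpace X] {Φ : ℝ → ℝ≥0∞} {μ : Measure X}

theorem luxNorm_le {f : X → ℝ} {r : ℝ≥0} (hr : 0 < r) (h : ∫⁻ x, Φ (f x / r) ∂μ ≤ 1) :
    luxNorm Φ μ f ≤ r :=
  iInf_le_of_le r (iInf_le_of_le hr (iInf_le _ h))

theorem lintegral_le_one_of_luxNorm_lt (hΦ : IsYoung Φ) {f : X → ℝ} {r : ℝ≥0}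
    (h : luxNorm Φ μ f < r) : 0 < r ∧ ∫⁻ x, Φ (f x / r) ∂μ ≤ 1 := by
  simp only [luxNorm, iInf_lt_iff] at h
  obtain ⟨s, hs, h1, hsr⟩ := h
  have hsr' : s < r := by exact_mod_cast hsr
  refine ⟨hs.trans hsr', le_trans (lintegral_mono fun x => ?_) h1⟩
  apply hΦ.mono_abs
  rw [abs_div, abs_div]
  have h2 : (s : ℝ) ≤ r := by exact_mod_cast hsr'.le
  have h3 : (0 : ℝ) < s := by exact_mod_cast hs
  rw [NNReal.abs_eq, NNReal.abs_eq]
  gcongr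

/-- Only radii strictly above `a` are tested: without lower semicontinuity of `Φ` the infimum
defining the norm need not be attained. -/
theorem luxNorm_le_of_forall_lt {f : X → ℝ} {a : ℝ≥0∞}
    (h : ∀ r : ℝ≥0, a < r → ∫⁻ x, Φ (f x / r) ∂μ ≤ 1) : luxNorm Φ μ f ≤ a := by
  refine le_of_forall_gt fun c hc => ?_
  obtain ⟨r, har, hrc⟩ := ENNReal.lt_iff_exists_nnreal_btwn.1 hc
  have hr : 0 < r := by
    have := (zero_le (a := a)).trans_lt har
    exact_mod_cast this
  exact (luxNorm_le hr (h r har)).trans_lt hrc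

theorem luxNorm_mono_ae (hΦ : IsYoung Φ) {f g : X → ℝ} (h : ∀ᵐ x ∂μ, |f x| ≤ |g x|) :
    luxNorm Φ μ f ≤ luxNorm Φ μ g := by
  refine luxNorm_le_of_forall_lt fun r hr => ?_
  refine le_trans (lintegral_mono_ae ?_) (lintegral_le_one_of_luxNorm_lt hΦ hr).2
  filter_upwards [h] with x hx
  apply hΦ.mono_abs
  rw [abs_div, abs_div]
  gcongr

theorem luxNorm_mono (hΦ : IsYoung Φ) {f g : X → ℝ} (h : ∀ x, |f x| ≤ |g x|) :
    luxNorm Φ μ f ≤ luxNorm Φ μ g :=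
  luxNorm_mono_ae hΦ (Filter.Eventually.of_forall h)

theorem luxNorm_eq_zero_of_ae (hΦ : IsYoung Φ) {f : X → ℝ} (h : ∀ᵐ x ∂μ, f x = 0) :
    luxNorm Φ μ f = 0 := by
  refine le_antisymm (luxNorm_le_of_forall_lt fun r _ => ?_) zero_le
  have : ∫⁻ x, Φ (f x / r) ∂μ = ∫⁻ _, 0 ∂μ := by
    refine lintegral_congr_ae ?_
    filter_upwards [h] with x hx
    simp [hx, hΦ.map_zero]
  simp [this]

theorem luxNorm_add_le (hΦ : IsYoung Φ) {f g : X → ℝ} (hf : Measurable f) :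
    luxNorm Φ μ (fun x => f x + g x) ≤ luxNorm Φ μ f + luxNorm Φ μ g := by
  refine le_of_forall_gt fun c hc => ?_
  obtain ⟨a, ha, b, hb, hab⟩ : ∃ a : ℝ≥0, luxNorm Φ μ f < a ∧ ∃ b : ℝ≥0, luxNorm Φ μ g < b ∧
      (a : ℝ≥0∞) + b < c := by
    have hf' : luxNorm Φ μ f ≠ ⊤ := fun h => by simp [h] at hc
    have hg' : luxNorm Φ μ g ≠ ⊤ := fun h => by simp [h] at hc
    obtain ⟨u, hu1, hu2⟩ := ENNReal.lt_iff_exists_add_pos_lt.1 hc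
    lift luxNorm Φ μ f to ℝ≥0 using hf' with p
    lift luxNorm Φ μ g to ℝ≥0 using hg' with q
    have hu : (0 : ℝ≥0∞) < (u / 2 : ℝ≥0) := by exact_mod_cast half_pos hu1
    refine ⟨p + u / 2, ?_, q + u / 2, ?_, ?_⟩
    · exact_mod_cast lt_add_of_pos_right p (half_pos hu1)
    · exact_mod_cast lt_add_of_pos_right q (half_pos hu1)
    · convert hu2 using 1
      norm_cast
      rw [add_add_add_comm, add_halves]
  obtain ⟨ha0, ha1⟩ := lintegral_le_one_of_luxNorm_lt hΦ ha
  obtain ⟨hb0, hb1⟩ := lintegral_le_one_of_luxNorm_lt hΦ hb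
  have hab0 : 0 < a + b := by positivity
  -- `(f + g)/(a + b)` is the convex combination of `f/a` and `g/b` with these weights.
  have hsum : a / (a + b) + b / (a + b) = 1 := by rw [← add_div, div_self hab0.ne']
  have key : ∫⁻ x, Φ ((f x + g x) / (a + b : ℝ≥0)) ∂μ ≤ 1 := by
    calc ∫⁻ x, Φ ((f x + g x) / (a + b : ℝ≥0)) ∂μ
        ≤ ∫⁻ x, ((a / (a + b) : ℝ≥0) : ℝ≥0∞) * Φ (f x / a)
            + ((b / (a + b) : ℝ≥0) : ℝ≥0∞) * Φ (g x / b) ∂μ := by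
          refine lintegral_mono fun x => ?_
          have h := hΦ.convex.2 (Set.mem_univ (f x / a)) (Set.mem_univ (g x / b))
            (zero_le (a := a / (a + b))) (zero_le (a := b / (a + b))) hsum
          simp only [NNReal.smul_def, ENNReal.smul_def, smul_eq_mul] at h
          have h1 : (a : ℝ) ≠ 0 := by exact_mod_cast ha0.ne'
          have h2 : (b : ℝ) ≠ 0 := by exact_mod_cast hb0.ne'
          have h3 : (a : ℝ) + b ≠ 0 := by exact_mod_cast hab0.ne'
          have h4 : (f x + g x) / (a + b : ℝ≥0) =
              (a / (a + b) : ℝ≥0) * (f x / a) + (b / (a + b) : ℝ≥0) * (g x / b) := by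
            push_cast
            field_simp
          rw [h4]
          exact h
      _ = ((a / (a + b) : ℝ≥0) : ℝ≥0∞) * ∫⁻ x, Φ (f x / a) ∂μ
            + ((b / (a + b) : ℝ≥0) : ℝ≥0∞) * ∫⁻ x, Φ (g x / b) ∂μ := by
          rw [lintegral_add_left, lintegral_const_mul', lintegral_const_mul']
          · exact ENNReal.coe_ne_top
          · exact ENNReal.coe_ne_top
          · exact (hΦ.measurable.comp (hf.div_const _)).const_mul _
      _ ≤ ((a / (a + b) : ℝ≥0) : ℝ≥0∞) * 1 + ((b / (a + b) : ℝ≥0) : ℝ≥0∞) * 1 := by gcongr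
      _ = 1 := by
          rw [mul_one, mul_one]
          exact_mod_cast hsum
  refine (luxNorm_le hab0 key).trans_lt ?_
  push_cast
  exact hab

theorem luxNorm_const_mul_le (hΦ : IsYoung Φ) {f : X → ℝ} (c : ℝ≥0) :
    luxNorm Φ μ (fun x => c * f x) ≤ c * luxNorm Φ μ f := by
  rcases eq_or_ne c 0 with rfl | hc
  · rw [luxNorm_eq_zero_of_ae hΦ (by simp)]
    exact zero_le
  refine luxNorm_le_of_forall_lt fun r hr => ?_
  have h : luxNorm Φ μ f < (r / c : ℝ≥0) := by
    rw [ENNReal.coe_div hc, ENNReal.lt_div_iff_mul_lt (by simp [hc]) (by simp)]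
    rwa [mul_comm]
  refine le_trans (le_of_eq ?_) (lintegral_le_one_of_luxNorm_lt hΦ h).2
  refine lintegral_congr fun x => ?_
  congr 1
  have h1 : (c : ℝ) ≠ 0 := by exact_mod_cast hc
  have h2 : (r : ℝ) ≠ 0 := by
    have h3 := (zero_le (a := c * luxNorm Φ μ f)).trans_lt hr
    exact_mod_cast h3.ne'
  push_cast
  field_simp

theorem luxNorm_sum_le (hΦ : IsYoung Φ) {ι : Type*} (s : Finset ι) {f : ι → X → ℝ}
    (hf : ∀ i, Measurable (f i)) :
    luxNorm Φ μ (fun x => ∑ i ∈ s, f i x) ≤ ∑ i ∈ s, luxNorm Φ μ (f i) := by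
  classical
  induction s using Finset.induction_on with
  | empty => simp [luxNorm_eq_zero_of_ae hΦ]
  | insert a s ha ih =>
    simp only [Finset.sum_insert ha]
    exact (luxNorm_add_le hΦ (hf a)).trans (by gcongr)

/-- A Fatou property of the Luxemburg norm, valid without lower semicontinuity of `Φ`. -/
theorem luxNorm_le_of_eventually_lt (hΦ : IsYoung Φ) {f : ℕ → X → ℝ} {g : X → ℝ} {a : ℝ≥0∞}
    (hfm : ∀ n, Measurable (f n)) (hg : ∀ᵐ x ∂μ, 0 ≤ g x)
    (hfg : ∀ᵐ x ∂μ, ∀ c, 0 ≤ c → c < g x → ∀ᶠ n in Filter.atTop, c ≤ f n x)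
    (ha : ∀ n, luxNorm Φ μ (f n) ≤ a) : luxNorm Φ μ g ≤ a := by
  refine luxNorm_le_of_forall_lt fun r hr => ?_
  obtain ⟨s, has, hsr⟩ := ENNReal.lt_iff_exists_nnreal_btwn.1 hr
  have hsr' : s < r := by exact_mod_cast hsr
  have hs : ∀ n, 0 < s ∧ ∫⁻ x, Φ (f n x / s) ∂μ ≤ 1 := fun n =>
    lintegral_le_one_of_luxNorm_lt hΦ ((ha n).trans_lt has)
  have hs0 : (0 : ℝ) < s := by exact_mod_cast (hs 0).1
  have hsr'' : (s : ℝ) < r := by exact_mod_cast hsr'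
  have hr0 : (0 : ℝ) < r := hs0.trans hsr''
  calc ∫⁻ x, Φ (g x / r) ∂μ
      ≤ ∫⁻ x, Filter.liminf (fun n => Φ (f n x / s)) Filter.atTop ∂μ := by
        refine lintegral_mono_ae ?_
        filter_upwards [hg, hfg] with x hx0 hx
        rcases hx0.eq_or_lt with h0 | h0
        · simp [← h0, hΦ.map_zero]
        -- The gap `s < r` stands in for lower semicontinuity: `g x * (s / r)` is strictly below `g
        -- x`, so `f n x` eventually exceeds it, and dividing by `s` gives `g x / r ≤ f n x / s`.
        have hlt : g x * (s / r) < g x := by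
          have : s / r < (1 : ℝ) := (div_lt_one hr0).2 hsr''
          nlinarith
        refine Filter.le_liminf_of_le (by isBoundedDefault) ?_
        filter_upwards [hx _ (by positivity) hlt] with n hn
        apply hΦ.mono_of_nonneg (by positivity)
        rwa [le_div_iff₀ hs0, div_mul_eq_mul_div, ← mul_div_assoc']
    _ ≤ Filter.liminf (fun n => ∫⁻ x, Φ (f n x / s) ∂μ) Filter.atTop :=
        lintegral_liminf_le fun n => hΦ.measurable.comp ((hfm n).div_const _)
    _ ≤ 1 := by
        refine Filter.liminf_le_of_frequently_le' (Filter.Frequently.of_forall fun n => (hs n).2)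

theorem luxInd_mono_ae (hΦ : IsYoung Φ) {A B : Set X} (h : ∀ᵐ x ∂μ, x ∈ A → x ∈ B) :
    luxInd Φ μ A ≤ luxInd Φ μ B := by
  refine luxNorm_mono_ae hΦ ?_
  filter_upwards [h] with x hx
  by_cases hA : x ∈ A
  · simp [hA, hx hA]
  · simp [hA]

theorem luxInd_mono (hΦ : IsYoung Φ) {A B : Set X} (h : A ⊆ B) :
    luxInd Φ μ A ≤ luxInd Φ μ B :=
  luxInd_mono_ae hΦ (Filter.Eventually.of_forall fun _ hx => h hx)

theorem luxInd_eq_zero (hΦ : IsYoung Φ) {A : Set X} (h : μ A = 0) : luxInd Φ μ A = 0 := by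
  refine luxNorm_eq_zero_of_ae hΦ ?_
  filter_upwards [measure_eq_zero_iff_ae_notMem.1 h] with x hx
  simp [hx]

theorem luxInd_le_of_eventually_mem (hΦ : IsYoung Φ) {A : ℕ → Set X} {S : Set X} {a : ℝ≥0∞}
    (hA : ∀ n, MeasurableSet (A n))
    (hAS : ∀ᵐ x ∂μ, x ∈ S → ∀ᶠ n in Filter.atTop, x ∈ A n)
    (ha : ∀ n, luxInd Φ μ (A n) ≤ a) : luxInd Φ μ S ≤ a := by
  refine luxNorm_le_of_eventually_lt hΦ (fun n => measurable_const.indicator (hA n))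
    (Filter.Eventually.of_forall fun x => Set.indicator_nonneg (by simp) x) ?_ ha
  filter_upwards [hAS] with x hx c hc hcx
  by_cases hxS : x ∈ S
  · filter_upwards [hx hxS] with n hn
    simp only [hxS, hn, Set.indicator_of_mem] at hcx ⊢
    exact hcx.le
  · simp only [hxS, not_false_eq_true, Set.indicator_of_notMem] at hcx
    exact absurd hcx hc.not_gt

/-- The Luxemburg norm is invariant under isomorphisms of measure spaces. -/
theorem luxNorm_map {Y : Type*} [MeasurableSpace Y] (e : X ≃ᵐ Y) (f : Y → ℝ) :
    luxNorm Φ (μ.map e) f = luxNorm Φ μ (fun x => f (e x)) := by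
  simp only [luxNorm, lintegral_map_equiv]

theorem luxInd_map {Y : Type*} [MeasurableSpace Y] (e : X ≃ᵐ Y) (A : Set Y) :
    luxInd Φ (μ.map e) A = luxInd Φ μ (e ⁻¹' A) := by
  rw [luxInd, luxNorm_map]
  rfl

end LuxNorm

/-! ### Capacitary estimate by geometric levels. -/

section Levels

/-- A geometric sum over the levels above `s`. -/
theorem sum_geometric_levels_le {q a s : ℝ} (hq : 1 < q) (ha : 0 < a) (hs : 0 ≤ s) (M : ℕ) :
    ∑ j ∈ Finset.range M, (if s ≤ a * q ^ j then
      ((a * q ^ (j + 1)) ^ 2 - (a * q ^ j) ^ 2) * (s ^ 2 / (a * q ^ j) ^ 4) else 0) ≤ q ^ 2 := by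
  -- The sharper bound makes the induction close: with `t = a * q ^ M ≥ s`, the new term `(q² -
  -- 1)s²/t²` turns `q²(1 - s²/t²)` into exactly `q²(1 - s²/(tq)²)`.
  suffices h : ∑ j ∈ Finset.range M, (if s ≤ a * q ^ j then
      ((a * q ^ (j + 1)) ^ 2 - (a * q ^ j) ^ 2) * (s ^ 2 / (a * q ^ j) ^ 4) else 0)
      ≤ q ^ 2 * max 0 (1 - s ^ 2 / (a * q ^ M) ^ 2) by
    refine h.trans (mul_le_of_le_one_right (by positivity) (max_le zero_le_one ?_))
    have : 0 ≤ s ^ 2 / (a * q ^ M) ^ 2 := by positivity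
    linarith
  induction M with
  | zero => simp; positivity
  | succ M ih =>
    rw [Finset.sum_range_succ]
    have hq0 : 0 < q := by linarith
    have ht : 0 < a * q ^ M := by positivity
    set t := a * q ^ M with htdef
    have ht1 : a * q ^ (M + 1) = t * q := by rw [htdef]; ring
    rw [ht1]
    split_ifs with hst
    · have h1 : s ^ 2 / t ^ 2 ≤ 1 := (div_le_one (by positivity)).2 (by gcongr)
      rw [max_eq_right (by linarith)] at ih
      have h2 : ((t * q) ^ 2 - t ^ 2) * (s ^ 2 / t ^ 4) = (q ^ 2 - 1) * (s ^ 2 / t ^ 2) := by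
        field_simp
      have h3 : q ^ 2 * (1 - s ^ 2 / (t * q) ^ 2) = q ^ 2 - s ^ 2 / t ^ 2 := by
        field_simp
      have h4 : q ^ 2 * (1 - s ^ 2 / (t * q) ^ 2) ≤ q ^ 2 * max 0 (1 - s ^ 2 / (t * q) ^ 2) := by
        gcongr
        exact le_max_right _ _
      rw [h2]
      linarith
    · have h1 : 1 ≤ s ^ 2 / t ^ 2 := (one_le_div (by positivity)).2 (by
        have := (not_le.1 hst).le
        gcongr)
      rw [max_eq_left (by linarith)] at ih
      have h4 : 0 ≤ q ^ 2 * max 0 (1 - s ^ 2 / (t * q) ^ 2) := by positivity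
      linarith

theorem sq_le_sum_geometric_levels {q a s : ℝ} (hq : 1 < q) (ha : 0 < a) (hs : 0 ≤ s) (M : ℕ) :
    min s (a * q ^ M) ^ 2 - a ^ 2 ≤ ∑ j ∈ Finset.range M,
      ((a * q ^ (j + 1)) ^ 2 - (a * q ^ j) ^ 2) * (if a * q ^ j < s then 1 else 0) := by
  have hq0 : 0 < q := by linarith
  induction M with
  | zero =>
    simp only [pow_zero, mul_one, Finset.range_zero, Finset.sum_empty, sub_nonpos]
    have := min_le_right s a
    gcongr
  | succ M ih =>
    rw [Finset.sum_range_succ]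
    split_ifs with h
    · rw [min_eq_right h.le] at ih
      have h1 : min s (a * q ^ (M + 1)) ^ 2 ≤ (a * q ^ (M + 1)) ^ 2 := by
        have := min_le_right s (a * q ^ (M + 1))
        gcongr
      linarith
    · rw [min_eq_left (not_lt.1 h)] at ih
      have h1 : min s (a * q ^ (M + 1)) ^ 2 ≤ s ^ 2 := by
        have := min_le_left s (a * q ^ (M + 1))
        gcongr
      linarith

variable {X : Type*} [MeasurableSpace X] {Φ : ℝ → ℝ≥0∞} {μ ν : Measure X}

theorem luxNorm_sq_le_of_luxInd_le_of_one_lt (hΦ : IsYoung Φ) {F : X → ℝ} (hF : Measurable F)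
    (hF0 : ∀ x, 0 ≤ F x) {w : X → ℝ≥0∞} (hw : Measurable w) {B : ℝ≥0∞}
    (h : ∀ t : ℝ, 0 < t → luxInd Φ μ {x | t < F x} ≤
      B * ∫⁻ x in {x | 0 < F x ∧ F x ≤ t}, ENNReal.ofReal (4 * (F x ^ 2 / t ^ 4)) * w x ∂ν)
    {q : ℝ} (hq : 1 < q) :
    luxNorm Φ μ (fun x => F x ^ 2) ≤
      ENNReal.ofReal (4 * q ^ 2) * (B * ∫⁻ x in {x | 0 < F x}, w x ∂ν) := by
  have hq0 : 0 < q := by linarith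
  have hmeas : ∀ t : ℝ, MeasurableSet {x | t < F x} := fun t => measurableSet_lt measurable_const hF
  -- The `2N` levels run from `q ^ (-N)` up to `q ^ N`, so the step functions `g N` below dominate
  -- `F ^ 2 - q ^ (-2N)` as soon as `F ≤ q ^ N`.
  set a : ℕ → ℝ := fun N => (q ^ N)⁻¹ with hadef
  have ha : ∀ N, 0 < a N := fun N => by positivity
  set g : ℕ → X → ℝ := fun N x => ∑ j ∈ Finset.range (2 * N),
    ((a N * q ^ (j + 1)) ^ 2 - (a N * q ^ j) ^ 2) * {x | a N * q ^ j < F x}.indicator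
      (fun _ => (1 : ℝ)) x with hgdef
  have hd : ∀ N j, 0 ≤ (a N * q ^ (j + 1)) ^ 2 - (a N * q ^ j) ^ 2 := fun N j => by
    have h1 : a N * q ^ j ≤ a N * q ^ (j + 1) := by
      have := ha N
      gcongr
      · exact hq.le
      · simp
    have h2 : 0 ≤ a N * q ^ j := by have := ha N; positivity
    rw [sub_nonneg]
    gcongr
  have hterm : ∀ N j, Measurable fun x => ((a N * q ^ (j + 1)) ^ 2 - (a N * q ^ j) ^ 2) *
      {x | a N * q ^ j < F x}.indicator (fun _ => (1 : ℝ)) x := fun N j =>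
    (measurable_const.indicator (hmeas _)).const_mul _
  refine luxNorm_le_of_eventually_lt hΦ (f := g) (fun N => Finset.measurable_sum _
    fun j _ => hterm N j) (Filter.Eventually.of_forall fun x => sq_nonneg _) ?_ ?_
  · refine Filter.Eventually.of_forall fun x c hc hcx => ?_
    have h1 : ∀ᶠ N in Filter.atTop, F x ≤ q ^ N :=
      (tendsto_pow_atTop_atTop_of_one_lt hq).eventually_ge_atTop _
    have h2 : Filter.Tendsto (fun N => a N ^ 2) Filter.atTop (nhds 0) := by
      have h3 := ((tendsto_pow_atTop_atTop_of_one_lt hq).inv_tendsto_atTop).pow 2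
      simpa [hadef] using h3
    filter_upwards [h1, h2.eventually_lt_const (sub_pos.2 hcx)] with N hN1 hN2
    have h4 := sq_le_sum_geometric_levels hq (ha N) (hF0 x) (2 * N)
    have h5 : a N * q ^ (2 * N) = q ^ N := by
      rw [hadef, two_mul, pow_add]
      field_simp
    rw [h5, min_eq_left hN1] at h4
    have h6 : g N x = ∑ j ∈ Finset.range (2 * N),
      ((a N * q ^ (j + 1)) ^ 2 - (a N * q ^ j) ^ 2) * (if a N * q ^ j < F x then 1 else 0) := by
      simp only [hgdef, Set.indicator_apply, Set.mem_ofPred_eq]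
    rw [h6]
    linarith
  · intro N
    calc luxNorm Φ μ (g N)
        ≤ ∑ j ∈ Finset.range (2 * N), luxNorm Φ μ fun x =>
          ((a N * q ^ (j + 1)) ^ 2 - (a N * q ^ j) ^ 2) *
            {x | a N * q ^ j < F x}.indicator (fun _ => (1 : ℝ)) x :=
          luxNorm_sum_le hΦ _ (hterm N)
      _ ≤ ∑ j ∈ Finset.range (2 * N),
            ENNReal.ofReal ((a N * q ^ (j + 1)) ^ 2 - (a N * q ^ j) ^ 2) *
            (B * ∫⁻ x in {x | 0 < F x ∧ F x ≤ a N * q ^ j},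
              ENNReal.ofReal (4 * (F x ^ 2 / (a N * q ^ j) ^ 4)) * w x ∂ν) := by
          refine Finset.sum_le_sum fun j _ => ?_
          have h1 := luxNorm_const_mul_le (μ := μ) hΦ (f := {x | a N * q ^ j < F x}.indicator
            (fun _ => (1 : ℝ))) (Real.toNNReal ((a N * q ^ (j + 1)) ^ 2 - (a N * q ^ j) ^ 2))
          rw [Real.coe_toNNReal _ (hd N j)] at h1
          refine h1.trans ?_
          have h2 := h (a N * q ^ j) (by have := ha N; positivity)
          rw [ENNReal.ofReal]
          gcongr
          exact h2
      _ = B * ∑ j ∈ Finset.range (2 * N), ∫⁻ x in {x | 0 < F x},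
            ENNReal.ofReal (if F x ≤ a N * q ^ j then
            ((a N * q ^ (j + 1)) ^ 2 - (a N * q ^ j) ^ 2) * (F x ^ 2 / (a N * q ^ j) ^ 4) else 0)
              * (4 * w x) ∂ν := by
          rw [Finset.mul_sum]
          refine Finset.sum_congr rfl fun j _ => ?_
          rw [mul_left_comm, ← lintegral_const_mul' _ _ ENNReal.ofReal_ne_top]
          have h3 : MeasurableSet {x | F x ≤ a N * q ^ j} := measurableSet_le hF measurable_const
          have h4 : {x | 0 < F x ∧ F x ≤ a N * q ^ j} =
            {x | F x ≤ a N * q ^ j} ∩ {x | 0 < F x} := by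
              ext x; simp [and_comm]
          rw [h4, ← Measure.restrict_restrict h3, ← lintegral_indicator h3]
          congr 1
          refine lintegral_congr fun x => ?_
          rw [Set.indicator_apply]
          simp only [Set.mem_ofPred_eq]
          split_ifs with hx
          · rw [ENNReal.ofReal_mul (by norm_num : (0 : ℝ) ≤ 4), ENNReal.ofReal_mul (hd N j)]
            simp only [ENNReal.ofReal_ofNat]
            ring
          · simp
      _ = B * ∫⁻ x in {x | 0 < F x}, ∑ j ∈ Finset.range (2 * N),
            ENNReal.ofReal (if F x ≤ a N * q ^ j then
            ((a N * q ^ (j + 1)) ^ 2 - (a N * q ^ j) ^ 2) * (F x ^ 2 / (a N * q ^ j) ^ 4) else 0)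
              * (4 * w x) ∂ν := by
          rw [lintegral_finsetSum]
          intro j _
          refine Measurable.mul (Measurable.ennreal_ofReal (Measurable.ite ?_ ?_ ?_))
            (hw.const_mul _)
          · exact measurableSet_le hF measurable_const
          · exact ((hF.pow_const 2).div_const _).const_mul _
          · exact measurable_const
      -- After exchanging sum and integral, the weights at each point sum to at most `q ^ 2`,
      -- whatever `N` is.
      _ ≤ B * ∫⁻ x in {x | 0 < F x}, ENNReal.ofReal (q ^ 2) * (4 * w x) ∂ν := by
          gcongr with x
          rw [← Finset.sum_mul]
          gcongr
          rw [← ENNReal.ofReal_sum_of_nonneg]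
          · exact ENNReal.ofReal_le_ofReal (sum_geometric_levels_le hq (ha N) (hF0 x) _)
          · intro j _
            split_ifs
            · exact mul_nonneg (hd N j) (by positivity)
            · exact le_rfl
      _ = ENNReal.ofReal (4 * q ^ 2) * (B * ∫⁻ x in {x | 0 < F x}, w x ∂ν) := by
          simp only [← mul_assoc]
          rw [lintegral_const_mul' _ _ (by finiteness), ENNReal.ofReal_mul (by norm_num)]
          simp only [ENNReal.ofReal_ofNat]
          ring

/-- A strong-type capacitary estimate: bounds on the superlevel sets of `F` by the energies of the
functions `min ((F / t) ^ 2) 1` imply a bound on `F ^ 2`. -/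
theorem luxNorm_sq_le_of_luxInd_le (hΦ : IsYoung Φ) {F : X → ℝ} (hF : Measurable F)
    (hF0 : ∀ x, 0 ≤ F x) {w : X → ℝ≥0∞} (hw : Measurable w) {B : ℝ≥0∞}
    (h : ∀ t : ℝ, 0 < t → luxInd Φ μ {x | t < F x} ≤
      B * ∫⁻ x in {x | 0 < F x ∧ F x ≤ t}, ENNReal.ofReal (4 * (F x ^ 2 / t ^ 4)) * w x ∂ν) :
    luxNorm Φ μ (fun x => F x ^ 2) ≤ 4 * B * ∫⁻ x in {x | 0 < F x}, w x ∂ν := by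
  rw [mul_assoc]
  have h1 : Filter.Tendsto (fun q : ℝ => ENNReal.ofReal (4 * q ^ 2) *
      (B * ∫⁻ x in {x | 0 < F x}, w x ∂ν)) (nhdsWithin 1 (Set.Ioi 1))
      (nhds (ENNReal.ofReal (4 * 1 ^ 2) * (B * ∫⁻ x in {x | 0 < F x}, w x ∂ν))) := by
    refine ENNReal.Tendsto.mul_const ?_ (Or.inl (by norm_num))
    refine ENNReal.tendsto_ofReal (Filter.Tendsto.mono_left ?_ nhdsWithin_le_nhds)
    exact Continuous.tendsto (by fun_prop) _
  have h2 := ge_of_tendsto h1 (b := luxNorm Φ μ (fun x => F x ^ 2)) (by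
    filter_upwards [self_mem_nhdsWithin] with q hq
    exact luxNorm_sq_le_of_luxInd_le_of_one_lt hΦ hF hF0 hw h hq)
  simpa using h2

end Levels

/-! ### Existence of medians. -/

section Median

theorem exists_median {X : Type*} [MeasurableSpace X] (μ : Measure X) [IsProbabilityMeasure μ]
    {f : X → ℝ} (hf : Measurable f) :
    ∃ m, 1 / 2 ≤ μ {x | f x ≤ m} ∧ 1 / 2 ≤ μ {x | m ≤ f x} := by
  set P := μ.map f with hP
  have : IsProbabilityMeasure P := Measure.isProbabilityMeasure_map hf.aemeasurable
  suffices h : ∃ m, 1 / 2 ≤ P (Set.Iic m) ∧ 1 / 2 ≤ P (Set.Ici m) by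
    obtain ⟨m, h1, h2⟩ := h
    rw [hP, Measure.map_apply hf measurableSet_Iic] at h1
    rw [hP, Measure.map_apply hf measurableSet_Ici] at h2
    exact ⟨m, h1, h2⟩
  have hhalf : (1 / 2 : ℝ≥0∞) < 1 := ENNReal.half_lt_self one_ne_zero ENNReal.one_ne_top
  set S : Set ℝ := {t | 1 / 2 ≤ P (Set.Iic t)} with hS
  have hne : S.Nonempty := by
    have h1 := tendsto_measure_Iic_atTop P
    rw [measure_univ] at h1
    obtain ⟨t, ht⟩ := (h1.eventually_const_lt hhalf).exists
    exact ⟨t, ht.le⟩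
  have hbdd : BddBelow S := by
    have h1 := ENNReal.tendsto_ofReal (ProbabilityTheory.tendsto_cdf_atBot P)
    simp only [ProbabilityTheory.ofReal_cdf, ENNReal.ofReal_zero] at h1
    obtain ⟨t, ht⟩ := (h1.eventually_lt_const (by simp : (0 : ℝ≥0∞) < 1 / 2)).exists
    refine ⟨t, fun s hs => ?_⟩
    by_contra! hst
    exact absurd ((hs : _ ≤ _).trans (measure_mono (Set.Iic_subset_Iic.2 hst.le))) ht.not_ge
  -- The lower `1/2`-quantile: continuity of `P` along decreasing half-lines gives the first bound,
  -- and along increasing ones `P (Iio (sInf S)) ≤ 1 / 2`, whence the second.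
  refine ⟨sInf S, ?_, ?_⟩
  · have h1 : Set.Iic (sInf S) = ⋂ n : ℕ, Set.Iic (sInf S + 1 / (n + 1)) := by
      ext x
      simp only [Set.mem_Iic, Set.mem_iInter]
      refine ⟨fun h n => h.trans (le_add_of_nonneg_right (by positivity)), fun h => ?_⟩
      have h2 := tendsto_one_div_add_atTop_nhds_zero_nat (𝕜 := ℝ).const_add (sInf S)
      rw [add_zero] at h2
      exact ge_of_tendsto' h2 h
    have hanti : Antitone fun n : ℕ => Set.Iic (sInf S + 1 / ((n : ℝ) + 1)) := by
      intro a b hab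
      have : (1 : ℝ) / (b + 1) ≤ 1 / (a + 1) := by gcongr
      exact Set.Iic_subset_Iic.2 (by linarith)
    rw [h1, hanti.measure_iInter (fun n => measurableSet_Iic.nullMeasurableSet)
      ⟨0, measure_ne_top _ _⟩]
    refine le_iInf fun n => ?_
    obtain ⟨s, hs, hlt⟩ := exists_lt_of_csInf_lt hne
      (lt_add_of_pos_right (sInf S) (by positivity : (0 : ℝ) < 1 / ((n : ℝ) + 1)))
    exact (hs : _ ≤ _).trans (measure_mono (Set.Iic_subset_Iic.2 hlt.le))
  · have h1 : Set.Iio (sInf S) = ⋃ n : ℕ, Set.Iic (sInf S - 1 / (n + 1)) := by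
      ext x
      simp only [Set.mem_Iio, Set.mem_iUnion, Set.mem_Iic]
      refine ⟨fun h => ?_, fun ⟨n, hn⟩ => hn.trans_lt (sub_lt_self _ (by positivity))⟩
      obtain ⟨n, hn⟩ := exists_nat_one_div_lt (sub_pos.2 h)
      exact ⟨n, by linarith⟩
    have hmono : Monotone fun n : ℕ => Set.Iic (sInf S - 1 / ((n : ℝ) + 1)) := by
      intro a b hab
      have : (1 : ℝ) / (b + 1) ≤ 1 / (a + 1) := by gcongr
      exact Set.Iic_subset_Iic.2 (by linarith)
    have h2 : P (Set.Iio (sInf S)) ≤ 1 / 2 := by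
      rw [h1, hmono.measure_iUnion]
      refine iSup_le fun n => ?_
      by_contra! h3
      have h4 := csInf_le hbdd (show sInf S - 1 / ((n : ℝ) + 1) ∈ S from h3.le)
      have : (0 : ℝ) < 1 / ((n : ℝ) + 1) := by positivity
      linarith
    have h3 : P (Set.Ici (sInf S)) = 1 - P (Set.Iio (sInf S)) := by
      rw [← Set.compl_Iio, prob_compl_eq_one_sub measurableSet_Iio]
    rw [h3]
    calc (1 / 2 : ℝ≥0∞) = 1 - 1 / 2 := by simp
      _ ≤ 1 - P (Set.Iio (sInf S)) := by gcongr

theorem measure_lt_le_half {X : Type*} [MeasurableSpace X] {μ : Measure X} [IsProbabilityMeasure μ]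
    {f : X → ℝ} (hf : Measurable f) {m : ℝ} (h : 1 / 2 ≤ μ {x | f x ≤ m}) :
    μ {x | m < f x} ≤ 1 / 2 := by
  have h1 : {x | m < f x} = {x | f x ≤ m}ᶜ := by ext x; simp
  rw [h1, prob_compl_eq_one_sub (measurableSet_le hf measurable_const)]
  calc 1 - μ {x | f x ≤ m} ≤ 1 - 1 / 2 := by gcongr
    _ = 1 / 2 := by simp

end Median

/-! ### Change of centering. -/

section Centering

variable {X : Type*} [MeasurableSpace X] {Φ : ℝ → ℝ≥0∞} {μ : Measure X}

/-- Passing from centering at an arbitrary point to centering at the mean. -/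
theorem luxNorm_sub_mean_sq_le [IsProbabilityMeasure μ] (hΦ : IsYoung Φ) {k : ℝ≥0}
    (hk : MeanSqBound Φ μ k) {f : X → ℝ} (hfm : Measurable f) (hf : Integrable f μ) (m : ℝ) :
    luxNorm Φ μ (fun x => (f x - ∫ y, f y ∂μ) ^ 2) ≤
      2 * (1 + k) * luxNorm Φ μ (fun x => (f x - m) ^ 2) := by
  set N := luxNorm Φ μ (fun x => (f x - m) ^ 2) with hN
  rcases eq_or_ne N ⊤ with htop | htop
  · rw [htop, ENNReal.mul_top]
    · exact le_top
    · simp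
  have hm : Measurable fun x => f x - m := hfm.sub_const m
  -- A finite norm gives Orlicz membership, so the hypothesis on `k` applies to `f - m`, whose
  -- squared mean is `(μ(f) - m) ^ 2`.
  have hmem : MemOrlicz Φ μ (fun x => (f x - m) ^ 2) := by
    refine ⟨hm.pow_const 2, ?_⟩
    obtain ⟨r, hr, -⟩ := ENNReal.lt_iff_exists_nnreal_btwn.1 htop.lt_top
    obtain ⟨h1, h2⟩ := lintegral_le_one_of_luxNorm_lt hΦ hr
    refine ⟨(r : ℝ)⁻¹, by positivity, ?_⟩
    simp only [div_eq_inv_mul] at h2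
    exact h2.trans_lt ENNReal.one_lt_top
  have hk' := hk _ hm hmem
  have hmean : ∫ y, (f y - m) ∂μ = ∫ y, f y ∂μ - m := by
    rw [integral_sub hf (integrable_const m)]
    simp
  rw [hmean] at hk'
  calc luxNorm Φ μ (fun x => (f x - ∫ y, f y ∂μ) ^ 2)
      ≤ luxNorm Φ μ (fun x => (2 : ℝ≥0) * ((f x - m) ^ 2 + (∫ y, f y ∂μ - m) ^ 2)) := by
        refine luxNorm_mono hΦ fun x => ?_
        rw [abs_of_nonneg (sq_nonneg _), abs_of_nonneg (by positivity)]
        push_cast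
        nlinarith [sq_nonneg ((f x - m) + (∫ y, f y ∂μ - m))]
    _ ≤ (2 : ℝ≥0) * luxNorm Φ μ (fun x => (f x - m) ^ 2 + (∫ y, f y ∂μ - m) ^ 2) :=
        luxNorm_const_mul_le hΦ 2
    _ ≤ (2 : ℝ≥0) * (N + k * N) := by
        gcongr
        exact (luxNorm_add_le hΦ (hm.pow_const 2)).trans (by gcongr)
    _ = 2 * (1 + k) * N := by
        push_cast
        ring

end Centering

/-! ### Energies and truncated squares. -/

section Gradient

variable {E : Type*} [NormedAddCommGroup E] [InnerProductSpace ℝ E]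

theorem enorm_fderiv_eq_zero {f : E → ℝ} {x : E} (h : fderiv ℝ f x = 0) :
    ‖fderiv ℝ f x‖ₑ = 0 := by
  rw [← ofReal_norm, h, norm_zero, ENNReal.ofReal_zero]

variable [CompleteSpace E]

theorem enorm_gradient (f : E → ℝ) (x : E) : ‖gradient f x‖ₑ = ‖fderiv ℝ f x‖ₑ := by
  rw [← toDual_gradient, LinearIsometryEquiv.enorm_map]

variable [MeasurableSpace E]

theorem energy_eq (ν : Measure E) (f : E → ℝ) :
    energy ν f = ∫⁻ x, ‖fderiv ℝ f x‖ₑ ^ 2 ∂ν := by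
  simp only [energy, enorm_gradient]

variable {Φ : ℝ → ℝ≥0∞} {μ ν : Measure E}

theorem capacity_mono {A B : Set E} (h : A ⊆ B) : capacity ν μ A ≤ capacity ν μ B := by
  refine iInf_mono fun f => iInf_mono fun _ => iInf_mono' fun h1 => ⟨fun x => ⟨?_, (h1 x).2⟩, le_rfl⟩
  refine le_trans ?_ (h1 x).1
  exact Set.indicator_le_indicator_of_subset h (fun _ => zero_le_one) x

variable [BorelSpace E]

/-- Common end of both upper bounds: `8(1 + k)` is the centering cost `2(1 + k)` times the
capacitary constant 4. The centre `m` may depend on `f`. -/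
theorem osConst_le_of_forall [IsProbabilityMeasure μ] (hΦ : IsYoung Φ) {k : ℝ≥0}
    (hk : MeanSqBound Φ μ k) {B : ℝ≥0}
    (h : ∀ f : E → ℝ, ContDiff ℝ ∞ f →
      ∃ m, luxNorm Φ μ (fun x => (f x - m) ^ 2) ≤ 4 * B * energy ν f) :
    osConst Φ μ ν ≤ 8 * (1 + k) * B := by
  have h1 : (8 * (1 + k) * B : ℝ≥0∞) = (8 * (1 + k) * B : ℝ≥0) := by push_cast; rfl
  rw [h1]
  refine iInf_le_of_le _ (iInf_le _ fun f hf hfi => ?_)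
  obtain ⟨m, hm⟩ := h f hf
  refine (luxNorm_sub_mean_sq_le hΦ hk hf.continuous.measurable hfi m).trans ?_
  calc 2 * (1 + (k : ℝ≥0∞)) * luxNorm Φ μ (fun x => (f x - m) ^ 2)
      ≤ 2 * (1 + (k : ℝ≥0∞)) * (4 * B * energy ν f) := by gcongr
    _ = (8 * (1 + k) * B : ℝ≥0) * energy ν f := by
        push_cast
        ring

/-- The energy of the truncated square `min (((f - m)₊ / t) ^ 2) 1`. -/
theorem energy_min_sq_le {f : E → ℝ} (hf : ContDiff ℝ ∞ f) (m : ℝ) {t : ℝ} (ht : 0 < t) :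
    energy ν (fun x => min (max (f x - m) 0 ^ 2 / t ^ 2) 1) ≤
      ∫⁻ x in {x | 0 < max (f x - m) 0 ∧ max (f x - m) 0 ≤ t},
        ENNReal.ofReal (4 * (max (f x - m) 0 ^ 2 / t ^ 4)) * ‖fderiv ℝ f x‖ₑ ^ 2 ∂ν := by
  set φ : E → ℝ := fun x => min (max (f x - m) 0 ^ 2 / t ^ 2) 1 with hφ
  have hcont := hf.continuous
  have hms : MeasurableSet {x | 0 < max (f x - m) 0 ∧ max (f x - m) 0 ≤ t} := by
    have h1 : Measurable fun x => max (f x - m) 0 := by fun_prop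
    exact (measurableSet_lt measurable_const h1).inter (measurableSet_le h1 measurable_const)
  rw [energy_eq, ← lintegral_indicator hms]
  refine lintegral_mono fun x => ?_
  have hφ0 : ∀ y, 0 ≤ φ y := fun y => le_min (by positivity) zero_le_one
  have hφ1 : ∀ y, φ y ≤ 1 := fun y => min_le_right _ _
  rcases le_or_gt (f x) m with h1 | h1
  · have h2 : φ x = 0 := by
      simp [hφ, max_eq_right (sub_nonpos.2 h1)]
    have h3 : IsLocalMin φ x := Filter.Eventually.of_forall fun y => by rw [h2]; exact hφ0 y
    have h5 : ‖fderiv ℝ φ x‖ₑ = 0 := enorm_fderiv_eq_zero h3.fderiv_eq_zero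
    rw [h5, zero_pow two_ne_zero]
    exact zero_le
  rcases le_or_gt (m + t) (f x) with h2 | h2
  · have h3 : φ x = 1 := by
      have h4 : t ≤ max (f x - m) 0 := le_max_of_le_left (by linarith)
      refine min_eq_right ((one_le_div (by positivity)).2 (by gcongr))
    have h3 : IsLocalMax φ x := Filter.Eventually.of_forall fun y => by rw [h3]; exact hφ1 y
    have h5 : ‖fderiv ℝ φ x‖ₑ = 0 := enorm_fderiv_eq_zero h3.fderiv_eq_zero
    rw [h5, zero_pow two_ne_zero]
    exact zero_le
  have heq : φ =ᶠ[nhds x] fun y => (t ^ 2)⁻¹ * (f y - m) ^ 2 := by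
    filter_upwards [hcont.continuousAt.eventually (lt_mem_nhds h1),
      hcont.continuousAt.eventually (gt_mem_nhds h2)] with y hy1 hy2
    have h4 : max (f y - m) 0 = f y - m := max_eq_left (by linarith)
    simp only [hφ, h4]
    rw [min_eq_left, div_eq_inv_mul]
    rw [div_le_one (by positivity)]
    have : 0 ≤ f y - m := by linarith
    gcongr
    linarith
  have hd : HasFDerivAt f (fderiv ℝ f x) x := (hf.differentiable (by simp) x).hasFDerivAt
  have hd2 := ((hd.sub_const m).pow 2).const_mul (t ^ 2)⁻¹
  rw [heq.fderiv_eq, hd2.fderiv]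
  have h4 : max (f x - m) 0 = f x - m := max_eq_left (by linarith)
  rw [Set.indicator_of_mem (by simp only [Set.mem_ofPred_eq, h4]; constructor <;> linarith), h4]
  rw [smul_smul, enorm_smul, mul_pow]
  gcongr
  rw [Real.enorm_eq_ofReal_abs, ← ENNReal.ofReal_pow (abs_nonneg _), sq_abs]
  refine ENNReal.ofReal_le_ofReal (le_of_eq ?_)
  simp
  field_simp
  ring

end Gradient

/-! ### Upper bound by the capacity constant. -/

section CapacityUpper

variable {E : Type*} [NormedAddCommGroup E] [InnerProductSpace ℝ E] [FiniteDimensional ℝ E]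
  [MeasurableSpace E] [BorelSpace E] {Φ : ℝ → ℝ≥0∞} {lam μ ν : Measure E}

/-- The capacity inequality extends from sets of measure `< 1 / 2` to sets of measure `≤ 1 / 2`. -/
theorem luxInd_le_of_measure_le_half [lam.IsAddHaarMeasure] [IsProbabilityMeasure μ] (hμ : μ ≪ lam)
    (hΦ : IsYoung Φ) {B : ℝ≥0}
    (h : ∀ A : Set E, MeasurableSet A → μ A < 1 / 2 → luxInd Φ μ A ≤ B * capacity ν μ A)
    {A : Set E} (hA : MeasurableSet A) (hA2 : μ A ≤ 1 / 2) :
    luxInd Φ μ A ≤ B * capacity ν μ A := by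
  rcases eq_or_ne (μ A) 0 with h0 | h0
  · exact h A hA (by simp [h0])
  obtain ⟨x, hxA, hx⟩ := exists_mem_forall_mem_nhdsWithin_pos_measure h0
  have hx0 : μ {x} = 0 := by
    -- In dimension 0 points are not null, but then a nonempty `A` is the whole space, of measure 1.
    rcases subsingleton_or_nontrivial E with hE | hE
    · have h1 : A = Set.univ := by
        ext y
        simp [Subsingleton.elim y x, hxA]
      rw [h1, measure_univ] at hA2
      exact absurd hA2 (ENNReal.half_lt_self one_ne_zero ENNReal.one_ne_top).not_ge
    · exact hμ (measure_singleton x)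
  refine luxInd_le_of_eventually_mem hΦ (A := fun n : ℕ => A \ Metric.closedBall x (1 / (n + 1)))
    (fun n => hA.diff measurableSet_closedBall) ?_ fun n => ?_
  · filter_upwards [measure_eq_zero_iff_ae_notMem.1 hx0] with y hy hyA
    have h1 : 0 < dist y x := dist_pos.2 hy
    filter_upwards [tendsto_one_div_add_atTop_nhds_zero_nat (𝕜 := ℝ).eventually_lt_const h1]
      with n hn
    exact ⟨hyA, fun hmem => (Metric.mem_closedBall.1 hmem).not_gt hn⟩
  · have h1 : 0 < μ (A ∩ Metric.closedBall x (1 / (n + 1))) :=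
      hx _ (Filter.inter_mem self_mem_nhdsWithin
        (mem_nhdsWithin_of_mem_nhds (Metric.closedBall_mem_nhds x (by positivity))))
    have h2 := measure_inter_add_sdiff (μ := μ) A
      (measurableSet_closedBall (x := x) (ε := 1 / ((n : ℝ) + 1)))
    have h3 : μ (A \ Metric.closedBall x (1 / ((n : ℝ) + 1))) < 1 / 2 := by
      refine lt_of_lt_of_le ?_ hA2
      rw [← h2, add_comm (μ (A ∩ _))]
      exact ENNReal.lt_add_right (measure_ne_top μ _) h1.ne'
    refine (h _ (hA.diff measurableSet_closedBall) h3).trans ?_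
    gcongr
    exact capacity_mono Set.sdiff_subset

theorem luxNorm_posPart_sq_le [lam.IsAddHaarMeasure] [IsProbabilityMeasure μ] (hμ : μ ≪ lam)
    (hΦ : IsYoung Φ) {B : ℝ≥0}
    (h : ∀ A : Set E, MeasurableSet A → μ A < 1 / 2 → luxInd Φ μ A ≤ B * capacity ν μ A)
    {f : E → ℝ} (hf : ContDiff ℝ ∞ f) {m : ℝ} (hm : 1 / 2 ≤ μ {x | f x ≤ m}) :
    luxNorm Φ μ (fun x => max (f x - m) 0 ^ 2) ≤
      4 * B * ∫⁻ x in {x | m < f x}, ‖fderiv ℝ f x‖ₑ ^ 2 ∂ν := by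
  have hcont := hf.continuous
  have h1 : {x | m < f x} = {x | 0 < max (f x - m) 0} := by ext x; simp
  rw [h1]
  refine luxNorm_sq_le_of_luxInd_le hΦ (by fun_prop) (fun x => le_max_right _ _)
    ((measurable_fderiv ℝ f).enorm.pow_const 2) fun t ht => ?_
  have hA : MeasurableSet {x | t < max (f x - m) 0} := by
    refine measurableSet_lt measurable_const ?_
    fun_prop
  have hA2 : μ {x | t < max (f x - m) 0} ≤ 1 / 2 := by
    refine (measure_mono fun x hx => ?_).trans (measure_lt_le_half hcont.measurable hm)
    have h2 : t < max (f x - m) 0 := hx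
    rcases lt_max_iff.1 h2 with h3 | h3
    · exact show m < f x by linarith
    · linarith
  refine (luxInd_le_of_measure_le_half hμ hΦ h hA hA2).trans ?_
  gcongr
  refine le_trans ?_ (energy_min_sq_le hf m ht)
  refine iInf_le_of_le _ (iInf_le_of_le ?_ (iInf_le_of_le (fun x => ⟨?_, min_le_right _ _⟩)
    (iInf_le _ ?_)))
  · have h2 : LocallyLipschitz f := (hf.of_le (by simp)).locallyLipschitz
    have h3 : LocallyLipschitz fun s : ℝ => max (s - m) 0 :=
      (((contDiff_id.sub contDiff_const).locallyLipschitz (𝕂 := ℝ)).max_const 0)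
    have h4 : LocallyLipschitz fun s : ℝ => s ^ 2 / t ^ 2 :=
      ContDiff.locallyLipschitz (𝕂 := ℝ) (by fun_prop)
    exact (h4.comp (h3.comp h2)).min_const 1
  · by_cases hx : x ∈ {x | t < max (f x - m) 0}
    · rw [Set.indicator_of_mem hx]
      have h2 : t < max (f x - m) 0 := hx
      exact le_min ((one_le_div (by positivity)).2 (by gcongr)) le_rfl
    · rw [Set.indicator_of_notMem hx]
      exact le_min (by positivity) zero_le_one
  · refine hm.trans (measure_mono fun x hx => ?_)
    have h2 : f x ≤ m := hx
    simp [h2]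

theorem osConst_le_capConst [lam.IsAddHaarMeasure] [IsProbabilityMeasure μ] (hμ : μ ≪ lam)
    (hΦ : IsYoung Φ) {k : ℝ≥0} (hk : MeanSqBound Φ μ k) :
    osConst Φ μ ν ≤ 8 * (1 + (k : ℝ≥0∞)) * capConst Φ μ ν := by
  rw [capConst, ENNReal.mul_iInf_of_ne (by simp) (by finiteness)]
  refine le_iInf fun B => ?_
  rw [ENNReal.mul_iInf_of_ne (by simp) (by finiteness)]
  refine le_iInf fun h => osConst_le_of_forall hΦ hk fun f hf => ?_
  have hcont := hf.continuous
  obtain ⟨m, hm1, hm2⟩ := exists_median μ hcont.measurable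
  refine ⟨m, ?_⟩
  have h1 := luxNorm_posPart_sq_le hμ hΦ h hf hm1
  have h2 := luxNorm_posPart_sq_le hμ hΦ h hf.neg (m := -m) (by simpa using hm2)
  have h3 : ∀ x, ‖fderiv ℝ (fun x => -f x) x‖ₑ = ‖fderiv ℝ f x‖ₑ := fun x => by
    rw [fderiv_fun_neg, enorm_neg]
  simp only [h3, neg_lt_neg_iff] at h2
  have hdisj : Disjoint {x | m < f x} {x | f x < m} := by
    rw [Set.disjoint_left]
    exact fun x hx hx' => lt_asymm (a := m) (b := f x) hx hx'
  calc luxNorm Φ μ (fun x => (f x - m) ^ 2)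
      = luxNorm Φ μ (fun x => max (f x - m) 0 ^ 2 + max (-f x - -m) 0 ^ 2) := by
        congr 1
        funext x
        rcases le_total (f x) m with h4 | h4
        · rw [max_eq_right (by linarith), max_eq_left (by linarith)]
          ring
        · rw [max_eq_left (by linarith), max_eq_right (by linarith)]
          ring
    _ ≤ luxNorm Φ μ (fun x => max (f x - m) 0 ^ 2) +
          luxNorm Φ μ (fun x => max (-f x - -m) 0 ^ 2) := luxNorm_add_le hΦ (by fun_prop)
    _ ≤ 4 * B * ∫⁻ x in {x | m < f x}, ‖fderiv ℝ f x‖ₑ ^ 2 ∂ν +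
          4 * B * ∫⁻ x in {x | f x < m}, ‖fderiv ℝ f x‖ₑ ^ 2 ∂ν := add_le_add h1 h2
    _ = 4 * B * ∫⁻ x in {x | m < f x} ∪ {x | f x < m}, ‖fderiv ℝ f x‖ₑ ^ 2 ∂ν := by
        rw [lintegral_union (measurableSet_lt hcont.measurable measurable_const) hdisj, mul_add]
    _ ≤ 4 * B * energy ν f := by
        rw [energy_eq]
        gcongr
        exact Measure.restrict_le_self

end CapacityUpper

/-! ### Smooth approximation of Lipschitz functions. -/

section Mollification

open scoped Convolution

variable {E : Type*} [NormedAddCommGroup E] [InnerProductSpace ℝ E] [FiniteDimensional ℝ E]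
  [MeasurableSpace E] [BorelSpace E] {lam : Measure E} [lam.IsAddHaarMeasure]

/-- The derivative of the convolution of a mollifier and a Lipschitz function. -/
theorem hasFDerivAt_normed_convolution {g : E → ℝ} {K : ℝ≥0} (hg : LipschitzWith K g)
    (φ : ContDiffBump (0 : E)) (x : E) :
    HasFDerivAt (φ.normed lam ⋆[ContinuousLinearMap.lsmul ℝ ℝ, lam] g)
      ((φ.normed lam ⋆[ContinuousLinearMap.lsmul ℝ ℝ, lam] fderiv ℝ g) x) x := by
  have hφc : Continuous (φ.normed lam) := φ.continuous_normed
  have hφi : Integrable (φ.normed lam) lam := φ.integrable_normed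
  have hsub : ∀ y : E, Continuous fun t => g (y - t) := fun y =>
    hg.continuous.comp (continuous_const.sub continuous_id)
  have key := (hasFDerivAt_integral_of_dominated_loc_of_lip (μ := lam) (𝕜 := ℝ)
    (F := fun y t => φ.normed lam t * g (y - t))
    (F' := fun t => φ.normed lam t • fderiv ℝ g (x - t)) (x₀ := x) (s := Set.univ)
    (bound := fun t => φ.normed lam t * K) Filter.univ_mem ?_ ?_ ?_ ?_ ?_ ?_).2
  · exact key
  · exact Filter.Eventually.of_forall fun y => (hφc.mul (hsub y)).aestronglyMeasurable
  · exact (hφc.mul (hsub x)).integrable_of_hasCompactSupport φ.hasCompactSupport_normed.mul_right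
  · exact (hφc.measurable.smul ((measurable_fderiv ℝ g).comp
      (measurable_const.sub measurable_id))).aestronglyMeasurable
  · refine Filter.Eventually.of_forall fun t => LipschitzOnWith.of_dist_le_mul fun y _ z _ => ?_
    have h1 : 0 ≤ φ.normed lam t := φ.nonneg_normed t
    have h2 : 0 ≤ φ.normed lam t * K := mul_nonneg h1 K.2
    rw [Real.dist_eq, ← mul_sub, abs_mul, abs_of_nonneg h1, Real.coe_nnabs,
      abs_of_nonneg h2, mul_assoc, ← Real.dist_eq]
    gcongr
    simpa using hg.dist_le_mul (y - t) (z - t)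
  · exact hφi.mul_const _
  · have h1 := (Measure.measurePreserving_sub_left lam x).quasiMeasurePreserving.ae
      (hg.ae_differentiableAt (μ := lam))
    filter_upwards [h1] with t ht
    have h2 : HasFDerivAt (fun y => g (y - t)) (fderiv ℝ g (x - t)) x :=
      (hasFDerivAt_comp_sub t).2 ht.hasFDerivAt
    exact h2.const_mul _

/-- Mollifications `h n` of `g` keep the Lipschitz constant `K`, and their derivatives are the
mollified `fderiv ℝ g`, which converge at almost every point by Lebesgue differentiation. Dominated
convergence with the constant `K ^ 2` applies since `ν` is finite. -/
theorem exists_contDiff_tendsto_energy {ν : Measure E} [IsFiniteMeasure ν] (hν : ν ≪ lam)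
    {g : E → ℝ} {K : ℝ≥0} (hg : LipschitzWith K g) :
    ∃ h : ℕ → E → ℝ, (∀ n, ContDiff ℝ ∞ (h n)) ∧
      (∀ δ > 0, ∀ᶠ n in Filter.atTop, ∀ x, |h n x - g x| ≤ δ) ∧
      Filter.Tendsto (fun n => energy ν (h n)) Filter.atTop (nhds (energy ν g)) := by
  -- The ratio 2 of outer to inner radius stays bounded, as the almost everywhere convergence of the
  -- mollified derivative requires.
  let φ : ℕ → ContDiffBump (0 : E) := fun n =>
    ⟨1 / (n + 1), 2 * (1 / (n + 1)), by positivity,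
      lt_mul_of_one_lt_left (by positivity) one_lt_two⟩
  have hrout : Filter.Tendsto (fun n => (φ n).rOut) Filter.atTop (nhds 0) := by
    have h1 := tendsto_one_div_add_atTop_nhds_zero_nat (𝕜 := ℝ).const_mul 2
    rwa [mul_zero] at h1
  set h : ℕ → E → ℝ := fun n => (φ n).normed lam ⋆[ContinuousLinearMap.lsmul ℝ ℝ, lam] g with hh
  have hdist : ∀ n x, |h n x - g x| ≤ K * (φ n).rOut := fun n x => by
    rw [← Real.dist_eq]
    refine ContDiffBump.dist_normed_convolution_le hg.continuous.aestronglyMeasurable fun y hy => ?_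
    exact hg.dist_le_mul_of_le (Metric.mem_ball.1 hy).le
  have hlip : ∀ n, LipschitzWith K (h n) := fun n => by
    have hφc : Continuous ((φ n).normed lam) := (φ n).continuous_normed
    have hint : ∀ y, Integrable (fun t => (φ n).normed lam t * g (y - t)) lam := fun y =>
      (hφc.mul (hg.continuous.comp (continuous_const.sub
        continuous_id))).integrable_of_hasCompactSupport (φ n).hasCompactSupport_normed.mul_right
    refine LipschitzWith.of_dist_le_mul fun y z => ?_
    have h1 : h n y - h n z = ∫ t, (φ n).normed lam t * (g (y - t) - g (z - t)) ∂lam := by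
      simp only [mul_sub]
      rw [integral_sub (hint y) (hint z)]
      rfl
    rw [Real.dist_eq, h1, ← Real.norm_eq_abs]
    refine (norm_integral_le_of_norm_le (((φ n).integrable_normed (μ := lam)).mul_const
      (K * dist y z)) (Filter.Eventually.of_forall fun t => ?_)).trans_eq ?_
    · have h2 : 0 ≤ (φ n).normed lam t := (φ n).nonneg_normed t
      rw [norm_mul, Real.norm_of_nonneg h2, ← dist_eq_norm]
      gcongr
      simpa using hg.dist_le_mul (y - t) (z - t)
    · rw [integral_mul_const, (φ n).integral_normed, one_mul]
  refine ⟨h, fun n => ?_, fun δ hδ => ?_, ?_⟩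
  · exact (φ n).hasCompactSupport_normed.contDiff_convolution_left _ (φ n).contDiff_normed
      hg.continuous.locallyIntegrable
  · have h1 := hrout.const_mul (K : ℝ)
    rw [mul_zero] at h1
    filter_upwards [h1.eventually_lt_const hδ] with n hn x
    exact (hdist n x).trans hn.le
  · simp only [energy_eq]
    refine tendsto_lintegral_of_dominated_convergence (fun _ => (K : ℝ≥0∞) ^ 2)
      (fun n => (measurable_fderiv ℝ (h n)).enorm.pow_const 2)
      (fun n => Filter.Eventually.of_forall fun x => ?_) ?_ ?_
    · have h1 : ‖fderiv ℝ (h n) x‖ₑ ≤ K := by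
        rw [← ofReal_norm, ← ENNReal.ofReal_coe_nnreal]
        exact ENNReal.ofReal_le_ofReal (norm_fderiv_le_of_lipschitz ℝ (hlip n))
      exact pow_le_pow_left' h1 2
    · rw [lintegral_const]
      exact ENNReal.mul_ne_top (by finiteness) (measure_ne_top _ _)
    · have hloc : LocallyIntegrable (fderiv ℝ g) lam := by
        refine LocallyIntegrable.mono (locallyIntegrable_const (K : ℝ))
          (measurable_fderiv ℝ g).aestronglyMeasurable (Filter.Eventually.of_forall fun x => ?_)
        rw [Real.norm_of_nonneg K.coe_nonneg]
        exact norm_fderiv_le_of_lipschitz ℝ hg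
      filter_upwards [hν (ContDiffBump.ae_convolution_tendsto_right_of_locallyIntegrable hrout
        (K := 2) (Filter.Eventually.of_forall fun n => le_rfl) hloc)] with x hx
      have h1 : ∀ n, fderiv ℝ (h n) x =
          ((φ n).normed lam ⋆[ContinuousLinearMap.lsmul ℝ ℝ, lam] fderiv ℝ g) x := fun n =>
        (hasFDerivAt_normed_convolution hg (φ n) x).fderiv
      simp only [h1]
      simp only [← ofReal_norm]
      exact ENNReal.Tendsto.pow (ENNReal.tendsto_ofReal hx.norm)

end Mollification

/-! ### Radial cutoffs. -/

section Cutoff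

variable {E : Type*} [NormedAddCommGroup E]

/-- The Lipschitz cutoff equal to `1` on the ball of radius `R` and to `0` outside of the ball of
radius `2 * R`. -/
noncomputable def radialCutoff (R : ℝ) (x : E) : ℝ := max (min (2 - R⁻¹ * ‖x‖) 1) 0

theorem radialCutoff_nonneg (R : ℝ) (x : E) : 0 ≤ radialCutoff R x := le_max_right _ _

theorem radialCutoff_le_one (R : ℝ) (x : E) : radialCutoff R x ≤ 1 :=
  max_le (min_le_right _ _) zero_le_one

theorem radialCutoff_eq_one {R : ℝ} (hR : 0 < R) {x : E} (hx : ‖x‖ ≤ R) :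
    radialCutoff R x = 1 := by
  have h1 : R⁻¹ * ‖x‖ ≤ 1 := by rwa [inv_mul_le_one₀ hR]
  rw [radialCutoff, min_eq_right (by linarith), max_eq_left zero_le_one]

theorem radialCutoff_eq_zero {R : ℝ} (hR : 0 < R) {x : E} (hx : 2 * R ≤ ‖x‖) :
    radialCutoff R x = 0 := by
  have h1 : 2 ≤ R⁻¹ * ‖x‖ := by rwa [inv_mul_eq_div, le_div_iff₀ hR]
  exact max_eq_right ((min_le_left _ _).trans (by linarith))

theorem lipschitzWith_radialCutoff {R : ℝ} (hR : 0 < R) :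
    LipschitzWith (Real.toNNReal R⁻¹) (radialCutoff R : E → ℝ) := by
  have h1 : LipschitzWith (Real.toNNReal R⁻¹) fun x : E => 2 - R⁻¹ * ‖x‖ := by
    refine LipschitzWith.of_dist_le_mul fun x y => ?_
    rw [Real.coe_toNNReal _ (by positivity), Real.dist_eq, dist_eq_norm]
    calc |2 - R⁻¹ * ‖x‖ - (2 - R⁻¹ * ‖y‖)| = R⁻¹ * |‖x‖ - ‖y‖| := by
          rw [← abs_of_pos (inv_pos.2 hR), ← abs_mul, abs_of_pos (inv_pos.2 hR), ← abs_neg]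
          ring_nf
      _ ≤ R⁻¹ * ‖x - y‖ := by
          gcongr
          exact abs_norm_sub_norm_le x y
  exact (h1.min_const 1).max_const 0

theorem locallyLipschitz_mul_radialCutoff {g : E → ℝ} (hg : LocallyLipschitz g) {R : ℝ}
    (hR : 0 < R) : LocallyLipschitz fun x => g x * radialCutoff R x := by
  have h1 : LocallyLipschitz fun p : ℝ × ℝ => p.1 * p.2 :=
    ContDiff.locallyLipschitz (𝕂 := ℝ) (by fun_prop)
  exact h1.comp (hg.prodMk (lipschitzWith_radialCutoff hR).locallyLipschitz)

variable [InnerProductSpace ℝ E] [FiniteDimensional ℝ E]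

/-- A locally Lipschitz function that vanishes outside of a ball is Lipschitz. -/
theorem LocallyLipschitz.exists_lipschitzWith_of_eq_zero {u : E → ℝ} (hu : LocallyLipschitz u)
    {R : ℝ} (hR : 0 < R) (hu0 : ∀ x, R ≤ ‖x‖ → u x = 0) : ∃ K, LipschitzWith K u := by
  obtain ⟨K, hK⟩ := (hu.locallyLipschitzOn
    (s := Metric.closedBall 0 (2 * R))).exists_lipschitzOnWith_of_compact
      (isCompact_closedBall 0 (2 * R))
  obtain ⟨M, hM⟩ := (isCompact_closedBall (0 : E) (2 * R)).exists_bound_of_continuousOn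
    hu.continuous.continuousOn
  have hMn : 0 ≤ M := (norm_nonneg _).trans (hM 0 (by simp [hR.le]))
  -- Compactness covers pairs inside the ball of radius `2R`. Across its boundary, either `u`
  -- vanishes at both points or they are at distance at least `R`, and the bound `M` on `u`
  -- suffices.
  have hfar : ∀ x y, ‖x‖ ≤ 2 * R → 2 * R < ‖y‖ → |u x - u y| ≤ (K + M / R) * ‖x - y‖ := by
    intro x y hx hy
    rw [hu0 y (by linarith), sub_zero]
    by_cases hxR : R ≤ ‖x‖
    · rw [hu0 x hxR, abs_zero]
      positivity
    · have h1 : R ≤ ‖x - y‖ := by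
        have := norm_sub_norm_le y x
        rw [norm_sub_rev] at this
        linarith
      have h2 : |u x| ≤ M := hM x (by simpa using hx)
      calc |u x| ≤ M / R * R := by rwa [div_mul_cancel₀ _ hR.ne']
        _ ≤ M / R * ‖x - y‖ := by gcongr
        _ ≤ (K + M / R) * ‖x - y‖ := by
            gcongr
            exact le_add_of_nonneg_left K.coe_nonneg
  refine ⟨K + Real.toNNReal (M / R), LipschitzWith.of_dist_le_mul fun x y => ?_⟩
  rw [NNReal.coe_add, Real.coe_toNNReal _ (by positivity), Real.dist_eq, dist_eq_norm]
  rcases le_or_gt ‖x‖ (2 * R) with hx | hx <;> rcases le_or_gt ‖y‖ (2 * R) with hy | hy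
  · have h1 := hK.dist_le_mul x (by simpa using hx) y (by simpa using hy)
    rw [Real.dist_eq, dist_eq_norm] at h1
    refine h1.trans ?_
    gcongr
    exact le_add_of_nonneg_right (by positivity)
  · exact hfar x y hx hy
  · rw [abs_sub_comm, norm_sub_rev]
    exact hfar y x hy hx
  · rw [hu0 x (by linarith), hu0 y (by linarith), sub_zero, abs_zero]
    positivity

theorem exists_lipschitzWith_mul_radialCutoff {g : E → ℝ} (hg : LocallyLipschitz g) {R : ℝ}
    (hR : 0 < R) : ∃ K, LipschitzWith K fun x => g x * radialCutoff R x :=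
  (locallyLipschitz_mul_radialCutoff hg hR).exists_lipschitzWith_of_eq_zero
    (by positivity : 0 < 2 * R) fun x hx => by rw [radialCutoff_eq_zero hR hx, mul_zero]

end Cutoff

/-! ### Lower bound by the capacity constant. -/

section CapacityLower

variable {E : Type*} [NormedAddCommGroup E] [InnerProductSpace ℝ E] [FiniteDimensional ℝ E]
  [MeasurableSpace E] [BorelSpace E] {Φ : ℝ → ℝ≥0∞} {lam μ ν : Measure E} [lam.IsAddHaarMeasure]
  [IsProbabilityMeasure μ] [IsProbabilityMeasure ν]

theorem luxInd_le_energy_of_lipschitz (hν : ν ≪ lam) (hΦ : IsYoung Φ) {C : ℝ≥0}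
    (hC : ∀ f : E → ℝ, ContDiff ℝ ∞ f → Integrable f μ →
      luxNorm Φ μ (fun x => (f x - ∫ y, f y ∂μ) ^ 2) ≤ C * energy ν f)
    {g : E → ℝ} {K : ℝ≥0} (hg : LipschitzWith K g) (hg0 : ∀ x, 0 ≤ g x) (hg1 : ∀ x, g x ≤ 1)
    (hgμ : 1 / 2 ≤ μ {x | g x = 0}) {A : Set E} (hA : ∀ x ∈ A, g x = 1) :
    luxInd Φ μ A ≤ 8 * C * energy ν g := by
  obtain ⟨h, hsm, hunif, hen⟩ := exists_contDiff_tendsto_energy hν hg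
  have hlim := ENNReal.Tendsto.const_mul (a := 8 * (C : ℝ≥0∞)) hen (Or.inr (by finiteness))
  refine ge_of_tendsto hlim ?_
  have hgc := hg.continuous
  have hgi : Integrable g μ := by
    refine Integrable.of_bound hgc.aestronglyMeasurable 1 (Filter.Eventually.of_forall fun x => ?_)
    rw [Real.norm_of_nonneg (hg0 x)]
    exact hg1 x
  have hms : MeasurableSet {x | g x = 0} := hgc.measurable (measurableSet_singleton 0)
  have hmean : ∫ x, g x ∂μ ≤ 1 / 2 := by
    calc ∫ x, g x ∂μ ≤ ∫ x, {x | g x = 0}ᶜ.indicator (fun _ => (1 : ℝ)) x ∂μ := by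
          refine integral_mono hgi ((integrable_const 1).indicator hms.compl) fun x => ?_
          by_cases hx : g x = 0
          · simp [hx]
          · simp [hx, hg1 x]
      _ = μ.real {x | g x = 0}ᶜ := by rw [integral_indicator_const _ hms.compl, smul_eq_mul, mul_one]
      _ = 1 - μ.real {x | g x = 0} := by rw [probReal_compl_eq_one_sub hms]
      _ ≤ 1 / 2 := by
          have h1 : (1 / 2 : ℝ) ≤ μ.real {x | g x = 0} := by
            have := ENNReal.toReal_mono (measure_ne_top _ _) hgμ
            simpa [Measure.real] using this
          linarith
  -- With error `1/16`, on `A` the function `h n` exceeds its mean by at least `15/16 - 9/16 = 3/8`,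
  -- and `8 · (3/8)² = 9/8 ≥ 1`.
  filter_upwards [hunif (1 / 16) (by norm_num)] with n hn
  have hni : Integrable (h n) μ := by
    refine Integrable.of_bound (hsm n).continuous.aestronglyMeasurable (1 + 1 / 16)
      (Filter.Eventually.of_forall fun x => ?_)
    rw [Real.norm_eq_abs, abs_le]
    have h1 := abs_le.1 (hn x)
    have h2 := hg0 x
    have h3 := hg1 x
    constructor <;> linarith
  have hnmean : ∫ x, h n x ∂μ ≤ 1 / 2 + 1 / 16 := by
    calc ∫ x, h n x ∂μ ≤ ∫ x, (g x + 1 / 16) ∂μ := by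
          refine integral_mono hni (hgi.add (integrable_const _)) fun x => ?_
          have h1 := abs_le.1 (hn x)
          show h n x ≤ g x + 1 / 16
          linarith
      _ = ∫ x, g x ∂μ + 1 / 16 := by
          rw [integral_add hgi (integrable_const _)]
          simp
      _ ≤ 1 / 2 + 1 / 16 := by linarith
  calc luxInd Φ μ A
      ≤ luxNorm Φ μ (fun x => (8 : ℝ≥0) * (h n x - ∫ y, h n y ∂μ) ^ 2) := by
        refine luxNorm_mono hΦ fun x => ?_
        rw [abs_of_nonneg (Set.indicator_nonneg (fun _ _ => zero_le_one) x),
          abs_of_nonneg (by positivity)]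
        by_cases hx : x ∈ A
        · rw [Set.indicator_of_mem hx]
          have h1 := abs_le.1 (hn x)
          rw [hA x hx] at h1
          push_cast
          nlinarith
        · rw [Set.indicator_of_notMem hx]
          positivity
    _ ≤ (8 : ℝ≥0) * luxNorm Φ μ (fun x => (h n x - ∫ y, h n y ∂μ) ^ 2) :=
        luxNorm_const_mul_le hΦ 8
    _ ≤ (8 : ℝ≥0) * (C * energy ν (h n)) := by
        gcongr
        exact hC _ (hsm n) hni
    _ = 8 * C * energy ν (h n) := by
        push_cast
        ring

/-- Rademacher's theorem for locally Lipschitz functions. -/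
theorem LocallyLipschitz.ae_differentiableAt {g : E → ℝ} (hg : LocallyLipschitz g) :
    ∀ᵐ x ∂lam, DifferentiableAt ℝ g x := by
  have h1 : ∀ n : ℕ, ∀ᵐ x ∂lam, DifferentiableAt ℝ (fun x => g x * radialCutoff (n + 1) x) x := by
    intro n
    obtain ⟨K, hK⟩ := exists_lipschitzWith_mul_radialCutoff hg (R := n + 1) (by positivity)
    exact hK.ae_differentiableAt
  filter_upwards [ae_all_iff.2 h1] with x hx
  obtain ⟨n, hn⟩ := exists_nat_gt ‖x‖
  refine (hx n).congr_of_eventuallyEq ?_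
  filter_upwards [continuous_norm.continuousAt.eventually (gt_mem_nhds hn)] with y hy
  rw [radialCutoff_eq_one (by positivity) (by linarith), mul_one]

theorem energy_mul_radialCutoff_le (hν : ν ≪ lam) {g : E → ℝ}
    (hg : LocallyLipschitz g) (hg0 : ∀ x, 0 ≤ g x) (hg1 : ∀ x, g x ≤ 1) {ε : ℝ≥0} (hε : 0 < ε) :
    energy ν (fun x => g x * radialCutoff (ε : ℝ)⁻¹ x) ≤ (1 + ε) * (energy ν g + ε) := by
  have hR : (0 : ℝ) < (ε : ℝ)⁻¹ := by positivity
  have hχ := lipschitzWith_radialCutoff (E := E) hR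
  rw [inv_inv, Real.toNNReal_coe] at hχ
  simp only [energy_eq]
  calc ∫⁻ x, ‖fderiv ℝ (fun x => g x * radialCutoff (ε : ℝ)⁻¹ x) x‖ₑ ^ 2 ∂ν
      ≤ ∫⁻ x, (1 + ε) * (‖fderiv ℝ g x‖ₑ ^ 2 + ε) ∂ν := by
        refine lintegral_mono_ae ?_
        filter_upwards [hν hg.ae_differentiableAt, hν (hχ.ae_differentiableAt (μ := lam))]
          with x hx1 hx2
        have h1 := hx1.hasFDerivAt.mul hx2.hasFDerivAt
        have h1' : fderiv ℝ (fun x => g x * radialCutoff (ε : ℝ)⁻¹ x) x = _ := h1.fderiv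
        have h2 : ‖fderiv ℝ (fun x => g x * radialCutoff (ε : ℝ)⁻¹ x) x‖ ≤
            ‖fderiv ℝ g x‖ + ε := by
          rw [h1']
          refine (norm_add_le _ _).trans ?_
          rw [norm_smul, norm_smul, Real.norm_of_nonneg (hg0 x),
            Real.norm_of_nonneg (radialCutoff_nonneg _ x), add_comm]
          have h3 : ‖fderiv ℝ (radialCutoff (ε : ℝ)⁻¹) x‖ ≤ ε := norm_fderiv_le_of_lipschitz ℝ hχ
          have h4 := radialCutoff_le_one (ε : ℝ)⁻¹ x
          have h5 := hg1 x
          have h6 := norm_nonneg (fderiv ℝ g x)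
          have h7 := norm_nonneg (fderiv ℝ (radialCutoff (ε : ℝ)⁻¹) x)
          refine add_le_add (mul_le_of_le_one_left h6 h4) ?_
          exact (mul_le_of_le_one_left h7 h5).trans h3
        have h3 : (1 + (ε : ℝ≥0∞)) * (‖fderiv ℝ g x‖ₑ ^ 2 + ε) =
            ENNReal.ofReal ((1 + ε) * (‖fderiv ℝ g x‖ ^ 2 + ε)) := by
          rw [ENNReal.ofReal_mul (by positivity), ENNReal.ofReal_add (by positivity) (by positivity),
            ENNReal.ofReal_add (by positivity) (by positivity), ENNReal.ofReal_pow (norm_nonneg _),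
            ofReal_norm, ENNReal.ofReal_one, ENNReal.ofReal_coe_nnreal]
        rw [h3, ← ofReal_norm, ← ENNReal.ofReal_pow (norm_nonneg _)]
        refine ENNReal.ofReal_le_ofReal ?_
        calc ‖fderiv ℝ (fun x => g x * radialCutoff (ε : ℝ)⁻¹ x) x‖ ^ 2
            ≤ (‖fderiv ℝ g x‖ + ε) ^ 2 := by gcongr
          -- With `p = ‖fderiv ℝ g x‖`, the difference of the two sides is `ε(p - 1)²`.
          _ ≤ (1 + ε) * (‖fderiv ℝ g x‖ ^ 2 + ε) := by
              have h4 : (0 : ℝ) ≤ ε := ε.coe_nonneg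
              nlinarith [mul_nonneg h4 (sq_nonneg (‖fderiv ℝ g x‖ - 1))]
    _ = (1 + ε) * (∫⁻ x, ‖fderiv ℝ g x‖ₑ ^ 2 ∂ν + ε) := by
        rw [lintegral_const_mul' _ _ (by finiteness), lintegral_add_right _ measurable_const]
        simp

/-- Cutting off at radius `n + 1` costs only a vanishing energy but keeps `g = 1` just on the part
of `A` in that ball; the Fatou property then recovers all of `A`. -/
theorem luxInd_le_energy (hν : ν ≪ lam) (hΦ : IsYoung Φ) {C : ℝ≥0}
    (hC : ∀ f : E → ℝ, ContDiff ℝ ∞ f → Integrable f μ →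
      luxNorm Φ μ (fun x => (f x - ∫ y, f y ∂μ) ^ 2) ≤ C * energy ν f)
    {g : E → ℝ} (hg : LocallyLipschitz g) (hg0 : ∀ x, 0 ≤ g x) (hg1 : ∀ x, g x ≤ 1)
    (hgμ : 1 / 2 ≤ μ {x | g x = 0}) {A : Set E} (hAm : MeasurableSet A) (hA : ∀ x ∈ A, g x = 1) :
    luxInd Φ μ A ≤ 8 * C * energy ν g := by
  set ε : ℕ → ℝ≥0 := fun n => 1 / (n + 1) with hε
  have hε0 : ∀ n, 0 < ε n := fun n => by positivity
  have hR : ∀ n, (0 : ℝ) < (ε n : ℝ)⁻¹ := fun n => by have := hε0 n; positivity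
  have hεinv : ∀ n, (ε n : ℝ)⁻¹ = n + 1 := fun n => by simp [hε]
  have hεlim : Filter.Tendsto (fun n => (ε n : ℝ≥0∞)) Filter.atTop (nhds 0) := by
    have h1 : Filter.Tendsto ε Filter.atTop (nhds 0) := tendsto_one_div_add_atTop_nhds_zero_nat
    exact ENNReal.tendsto_coe.2 h1
  have hn : ∀ n : ℕ, luxInd Φ μ (A ∩ Metric.closedBall 0 (n + 1)) ≤
      8 * C * ((1 + ε n) * (energy ν g + ε n)) := by
    intro n
    obtain ⟨K, hK⟩ := exists_lipschitzWith_mul_radialCutoff hg (hR n)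
    refine (luxInd_le_energy_of_lipschitz hν hΦ hC hK
      (fun x => mul_nonneg (hg0 x) (radialCutoff_nonneg _ x))
      (fun x => mul_le_one₀ (hg1 x) (radialCutoff_nonneg _ x) (radialCutoff_le_one _ x)) ?_ ?_).trans ?_
    · refine hgμ.trans (measure_mono fun x hx => ?_)
      have h1 : g x = 0 := hx
      simp [h1]
    · rintro x ⟨hxA, hxB⟩
      rw [hA x hxA, radialCutoff_eq_one (hR n), mul_one]
      rw [hεinv]
      simpa using hxB
    · gcongr
      exact energy_mul_radialCutoff_le hν hg hg0 hg1 (hε0 n)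
  have hlim : Filter.Tendsto (fun n => 8 * C * ((1 + (ε n : ℝ≥0∞)) * (energy ν g + ε n)))
      Filter.atTop (nhds (8 * C * ((1 + 0) * (energy ν g + 0)))) := by
    refine ENNReal.Tendsto.const_mul ?_ (Or.inr (by finiteness))
    refine ENNReal.Tendsto.mul (tendsto_const_nhds.add hεlim) (Or.inl (by simp))
      (tendsto_const_nhds.add hεlim) (Or.inr (by simp))
  rw [add_zero, add_zero, one_mul] at hlim
  refine luxInd_le_of_eventually_mem hΦ (A := fun n : ℕ => A ∩ Metric.closedBall 0 (n + 1))
    (fun n => hAm.inter measurableSet_closedBall) ?_ fun m => ?_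
  · refine Filter.Eventually.of_forall fun x hx => ?_
    filter_upwards [Filter.eventually_ge_atTop ⌈‖x‖⌉₊] with n hn
    refine ⟨hx, ?_⟩
    have h1 : ‖x‖ ≤ n := (Nat.le_ceil _).trans (by exact_mod_cast hn)
    simp only [Metric.mem_closedBall, dist_zero_right]
    linarith
  · refine ge_of_tendsto hlim ?_
    -- The set is frozen at index `m` while the error in the energy tends to 0.
    filter_upwards [Filter.eventually_ge_atTop m] with n hmn
    refine (luxInd_mono hΦ ?_).trans (hn n)
    refine Set.inter_subset_inter_right _ (Metric.closedBall_subset_closedBall ?_)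
    have h1 : (m : ℝ) ≤ n := by exact_mod_cast hmn
    linarith

theorem capConst_div_le_osConst (hν : ν ≪ lam) (hΦ : IsYoung Φ) :
    capConst Φ μ ν / 8 ≤ osConst Φ μ ν := by
  refine le_iInf fun C => le_iInf fun hC => ?_
  refine le_of_forall_gt fun c hc => ?_
  -- `C` may be 0 while the capacity is infinite, and `0 * ∞ = 0`; a slightly larger `D > 0` can be
  -- moved through the infima.
  obtain ⟨D, hCD, hDc⟩ := ENNReal.lt_iff_exists_nnreal_btwn.1 hc
  refine lt_of_le_of_lt ?_ hDc
  have hD : 0 < D := (zero_le (a := C)).trans_lt (by exact_mod_cast hCD)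
  rw [ENNReal.div_le_iff (by norm_num) (by norm_num)]
  have h8 : (D : ℝ≥0∞) * 8 = (8 * D : ℝ≥0) := by push_cast; ring
  rw [h8]
  refine iInf_le_of_le _ (iInf_le _ fun A hA _ => ?_)
  have hne : ((8 * D : ℝ≥0) : ℝ≥0∞) ≠ 0 := by
    have : (8 * D : ℝ≥0) ≠ 0 := by positivity
    exact_mod_cast this
  rw [capacity, ENNReal.mul_iInf_of_ne hne ENNReal.coe_ne_top]
  refine le_iInf fun g => ?_
  rw [ENNReal.mul_iInf_of_ne hne ENNReal.coe_ne_top]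
  refine le_iInf fun hg => ?_
  rw [ENNReal.mul_iInf_of_ne hne ENNReal.coe_ne_top]
  refine le_iInf fun hgA => ?_
  rw [ENNReal.mul_iInf_of_ne hne ENNReal.coe_ne_top]
  refine le_iInf fun hgμ => ?_
  refine (luxInd_le_energy hν hΦ hC hg
    (fun x => (Set.indicator_nonneg (fun _ _ => zero_le_one) x).trans (hgA x).1)
    (fun x => (hgA x).2) hgμ hA fun x hx => le_antisymm (hgA x).2 ?_).trans ?_
  · have h1 := (hgA x).1
    rwa [Set.indicator_of_mem hx] at h1
  · push_cast
    gcongr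

end CapacityLower

/-! ### Cauchy–Schwarz with a weight. -/

section WeightedCauchySchwarz

theorem sq_lintegral_le_mul_lintegral_inv {X : Type*} [MeasurableSpace X] {κ : Measure X}
    {u ρ : X → ℝ≥0∞} (hu : Measurable u) (hρ : Measurable ρ) (hρt : ∀ᵐ x ∂κ, ρ x ≠ ⊤)
    (hinv : ∫⁻ x, (ρ x)⁻¹ ∂κ ≠ ⊤) :
    (∫⁻ x, u x ∂κ) ^ 2 ≤ (∫⁻ x, u x ^ 2 * ρ x ∂κ) * ∫⁻ x, (ρ x)⁻¹ ∂κ := by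
  have h0 : ∀ᵐ x ∂κ, ρ x ≠ 0 := by
    filter_upwards [ae_lt_top hρ.inv hinv] with x hx h
    simp [h] at hx
  have h1 : ∫⁻ x, u x ∂κ = ∫⁻ x, (u x * ρ x ^ (1 / 2 : ℝ)) * (ρ x)⁻¹ ^ (1 / 2 : ℝ) ∂κ := by
    refine lintegral_congr_ae ?_
    filter_upwards [h0, hρt] with x hx0 hxt
    rw [mul_assoc, ← ENNReal.mul_rpow_of_nonneg _ _ (by norm_num), ENNReal.mul_inv_cancel hx0 hxt,
      ENNReal.one_rpow, mul_one]
  have h2 := ENNReal.lintegral_mul_le_Lp_mul_Lq κ Real.HolderConjugate.two_two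
    (f := fun x => u x * ρ x ^ (1 / 2 : ℝ)) (g := fun x => (ρ x)⁻¹ ^ (1 / 2 : ℝ))
    (hu.mul (hρ.pow_const _)).aemeasurable (hρ.inv.pow_const _).aemeasurable
  have hsq : ∀ a : ℝ≥0∞, (a ^ (1 / 2 : ℝ)) ^ (2 : ℝ) = a := fun a => by
    rw [← ENNReal.rpow_mul]
    norm_num
  have hsq' : ∀ a : ℝ≥0∞, (a ^ (1 / 2 : ℝ)) ^ 2 = a := fun a => by
    rw [← ENNReal.rpow_natCast]
    exact hsq a
  simp only [ENNReal.mul_rpow_of_nonneg _ _ zero_le_two, hsq, ENNReal.rpow_two] at h2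
  rw [h1]
  refine (pow_le_pow_left' h2 2).trans_eq ?_
  rw [mul_pow, hsq', hsq']

end WeightedCauchySchwarz

/-! ### Muckenhoupt-type bounds on the right half-line. -/

section Line

variable {Φ : ℝ → ℝ≥0∞} {μ ν : Measure ℝ} {ρ : ℝ → ℝ≥0∞} {m : ℝ}

theorem ae_ne_top_of_eq_withDensity [IsProbabilityMeasure ν] (hρ : Measurable ρ)
    (hν : ν = volume.withDensity ρ) : ∀ᵐ y, ρ y ≠ ⊤ := by
  have h1 : ∫⁻ y, ρ y ≠ ⊤ := by
    rw [← setLIntegral_univ, ← withDensity_apply ρ MeasurableSet.univ, ← hν]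
    exact measure_ne_top _ _
  filter_upwards [ae_lt_top hρ h1] with y hy using hy.ne

/-- The one-dimensional Hardy inequality on the right of the point `m`. -/
theorem luxNorm_indicator_Ioi_le [IsProbabilityMeasure ν] (hΦ : IsYoung Φ) (hρ : Measurable ρ)
    (hν : ν = volume.withDensity ρ) {B : ℝ≥0} (hB : muckPlus Φ μ ρ m ≤ B)
    {f : ℝ → ℝ} (hf : ContDiff ℝ ∞ f) :
    luxNorm Φ μ ((Set.Ioi m).indicator fun y => (f y - f m) ^ 2) ≤
      4 * B * ∫⁻ y in Set.Ioi m, ‖fderiv ℝ f y‖ₑ ^ 2 ∂ν := by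
  have hdiff : Differentiable ℝ f := hf.differentiable (by simp)
  have hd : Continuous fun y => |deriv f y| := (hf.continuous_deriv (by simp)).abs
  -- A monotone majorant of `|f - f m|` to the right of `m`, with derivative of the same modulus as
  -- that of `f`, so the energy does not change.
  set H : ℝ → ℝ := fun y => ∫ s in m..y, |deriv f s| with hH
  have hHd : ∀ y, HasDerivAt H |deriv f y| y := fun y =>
    intervalIntegral.integral_hasDerivAt_right (hd.intervalIntegrable _ _)
      (hd.stronglyMeasurableAtFilter _ _) hd.continuousAt
  have hHc : Continuous H := continuous_iff_continuousAt.2 fun y => (hHd y).continuousAt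
  have hHm : H m = 0 := intervalIntegral.integral_same
  have hHmono : Monotone H := monotone_of_deriv_nonneg (fun y => (hHd y).differentiableAt)
    fun y => by rw [(hHd y).deriv]; exact abs_nonneg _
  set G : ℝ → ℝ := fun y => H (max y m) with hG
  have hGc : Continuous G := by fun_prop
  have hG0 : ∀ y, 0 ≤ G y := fun y => by
    rw [← hHm]
    exact hHmono (le_max_right _ _)
  have hGmono : Monotone G := fun a b hab => hHmono (max_le_max_right m hab)
  have hGle : ∀ y, y ≤ m → G y = 0 := fun y hy => by
    simp only [hG]
    rw [max_eq_right hy, hHm]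
  have hGge : ∀ y, m ≤ y → G y = H y := fun y hy => by
    simp only [hG]
    rw [max_eq_left hy]
  have hw : Measurable fun y => ‖fderiv ℝ f y‖ₑ ^ 2 := (measurable_fderiv ℝ f).enorm.pow_const 2
  have hfG : ∀ y, m < y → |f y - f m| ≤ G y := fun y hy => by
    rw [hGge y hy.le, ← intervalIntegral.integral_deriv_eq_sub (fun z _ => hdiff z)
      ((hf.continuous_deriv (by simp)).intervalIntegrable _ _)]
    exact intervalIntegral.abs_integral_le_integral_abs hy.le
  have hkey : luxNorm Φ μ (fun y => G y ^ 2) ≤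
      4 * B * ∫⁻ y in {y | 0 < G y}, ‖fderiv ℝ f y‖ₑ ^ 2 ∂ν := by
    refine luxNorm_sq_le_of_luxInd_le hΦ hGc.measurable hG0 hw fun t ht => ?_
    rcases Set.eq_empty_or_nonempty {y | t < G y} with hemp | ⟨y₀, hy₀⟩
    · rw [hemp, luxInd_eq_zero hΦ measure_empty]
      exact zero_le
    have hy₀' : t < G y₀ := hy₀
    have hmy₀ : m ≤ y₀ := by
      by_contra! h
      rw [hGle y₀ h.le] at hy₀'
      linarith
    obtain ⟨x, ⟨hmx, -⟩, hx⟩ := intermediate_value_Icc hmy₀ hGc.continuousOn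
      ⟨(hGle m le_rfl).trans_le ht.le, hy₀'.le⟩
    have hmx' : m < x := by
      refine hmx.lt_of_ne fun h => ?_
      rw [← h, hGle m le_rfl] at hx
      linarith
    have hsub : {y | t < G y} ⊆ Set.Ici x := fun y hy => by
      by_contra h
      have h1 : G y ≤ G x := hGmono (not_le.1 h).le
      have h2 : t < G y := hy
      linarith
    have hxB : luxInd Φ μ (Set.Ici x) * ∫⁻ y in Set.Icc m x, (ρ y)⁻¹ ≤ B :=
      (le_iSup₂_of_le x hmx' le_rfl).trans hB
    refine (luxInd_mono hΦ hsub).trans ?_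
    set I := ∫⁻ y in Set.Icc m x, (ρ y)⁻¹ with hI
    -- If `I = ∞`, finiteness of `B` forces the norm of the indicator to vanish.
    rcases eq_or_ne I ⊤ with hIt | hIt
    · rcases eq_or_ne (luxInd Φ μ (Set.Ici x)) 0 with h0 | h0
      · rw [h0]
        exact zero_le
      · rw [hIt, ENNReal.mul_top h0] at hxB
        simp at hxB
    set u : ℝ → ℝ≥0∞ := fun y => ENNReal.ofReal (2 * G y / t ^ 2 * |deriv f y|) with hu
    have hum : Measurable u := by
      have h1 := hGc.measurable
      have h2 := hd.measurable
      exact (((h1.const_mul 2).div_const _).mul h2).ennreal_ofReal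
    have hu2 : ∀ y, u y ^ 2 = ENNReal.ofReal (4 * (G y ^ 2 / t ^ 4)) * ‖fderiv ℝ f y‖ₑ ^ 2 := by
      intro y
      have h1 : ‖fderiv ℝ f y‖ = |deriv f y| := norm_deriv_eq_norm_fderiv.symm
      rw [← ofReal_norm, h1, ← ENNReal.ofReal_pow (abs_nonneg _),
        ← ENNReal.ofReal_mul (by positivity), hu,
        ← ENNReal.ofReal_pow (mul_nonneg (div_nonneg (mul_nonneg zero_le_two (hG0 y))
          (by positivity)) (abs_nonneg _))]
      congr 1
      field_simp
      ring
    -- On `[m, x]`, `u` is the derivative of `(G / t) ^ 2`, which rises from 0 to 1. Cauchy–Schwarz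
    -- then gives `1 ≤ (∫ u² ρ) · I`.
    have hone : ∫⁻ y in Set.Icc m x, u y = 1 := by
      have hv : Continuous fun y => 2 * H y / t ^ 2 * |deriv f y| := by fun_prop
      have h1 : ∫ y in m..x, 2 * H y / t ^ 2 * |deriv f y| = 1 := by
        have h2 : ∀ y ∈ Set.uIcc m x, HasDerivAt (fun y => H y ^ 2 / t ^ 2)
            (2 * H y / t ^ 2 * |deriv f y|) y := fun y _ => by
          have h3 := ((hHd y).pow 2).div_const (t ^ 2)
          have h4 : 2 * H y / t ^ 2 * |deriv f y| =
            ((2 : ℕ) : ℝ) * H y ^ (2 - 1) * |deriv f y| / t ^ 2 := by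
              push_cast
              ring
          rw [h4]
          exact h3
        rw [intervalIntegral.integral_eq_sub_of_hasDerivAt h2 (hv.intervalIntegrable _ _), hHm,
          ← hGge x hmx, hx]
        field_simp
        ring
      rw [intervalIntegral.integral_of_le hmx, ← integral_Icc_eq_integral_Ioc] at h1
      rw [← ENNReal.ofReal_one, ← h1, ofReal_integral_eq_lintegral_ofReal]
      · refine setLIntegral_congr_fun measurableSet_Icc fun y hy => ?_
        simp only [hu]
        rw [hGge y hy.1]
      · exact hv.integrableOn_Icc
      · filter_upwards [ae_restrict_mem measurableSet_Icc] with y hy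
        rw [← hGge y hy.1]
        exact mul_nonneg (div_nonneg (mul_nonneg zero_le_two (hG0 y)) (by positivity))
          (abs_nonneg _)
    have hcs := sq_lintegral_le_mul_lintegral_inv (κ := volume.restrict (Set.Icc m x)) hum hρ
      (ae_restrict_of_ae (ae_ne_top_of_eq_withDensity hρ hν)) hIt
    rw [hone, one_pow] at hcs
    have hE : ∫⁻ y in Set.Icc m x, u y ^ 2 * ρ y ≤ ∫⁻ y in {y | 0 < G y ∧ G y ≤ t},
        ENNReal.ofReal (4 * (G y ^ 2 / t ^ 4)) * ‖fderiv ℝ f y‖ₑ ^ 2 ∂ν := by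
      simp only [← hu2]
      have hS : MeasurableSet {y | 0 < G y ∧ G y ≤ t} :=
        (measurableSet_lt measurable_const hGc.measurable).inter
          (measurableSet_le hGc.measurable measurable_const)
      rw [hν, restrict_withDensity hS, lintegral_withDensity_eq_lintegral_mul _ hρ (hum.pow_const 2),
        ← lintegral_indicator hS, ← lintegral_indicator measurableSet_Icc]
      refine lintegral_mono fun y => ?_
      by_cases hy : y ∈ Set.Icc m x
      · rw [Set.indicator_of_mem hy]
        rcases (hG0 y).eq_or_lt with h0 | h0
        · simp [hu, ← h0]
        · have h1 : y ∈ {y | 0 < G y ∧ G y ≤ t} := ⟨h0, hx ▸ hGmono hy.2⟩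
          rw [Set.indicator_of_mem h1, Pi.mul_apply, mul_comm]
      · rw [Set.indicator_of_notMem hy]
        exact zero_le
    calc luxInd Φ μ (Set.Ici x) = luxInd Φ μ (Set.Ici x) * 1 := (mul_one _).symm
      _ ≤ luxInd Φ μ (Set.Ici x) * ((∫⁻ y in Set.Icc m x, u y ^ 2 * ρ y) * I) := by gcongr
      _ = luxInd Φ μ (Set.Ici x) * I * ∫⁻ y in Set.Icc m x, u y ^ 2 * ρ y := by ring
      _ ≤ _ := mul_le_mul' hxB hE
  refine le_trans (luxNorm_mono hΦ fun y => ?_) (hkey.trans ?_)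
  · by_cases hy : y ∈ Set.Ioi m
    · rw [Set.indicator_of_mem hy, abs_pow, abs_of_nonneg (sq_nonneg (G y))]
      have := hfG y hy
      gcongr
    · rw [Set.indicator_of_notMem hy, abs_zero]
      exact abs_nonneg _
  · gcongr
    intro y hy
    by_contra h
    have h1 : 0 < G y := hy
    rw [hGle y (not_lt.1 h)] at h1
    exact lt_irrefl _ h1

/-- The test functions `∫ min (1 / ρ) N` show that Muckenhoupt's constant bounds the optimal
constant from below. -/
theorem muckPlus_div_le_osConst [IsProbabilityMeasure μ] [IsProbabilityMeasure ν] (hΦ : IsYoung Φ)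
    (hρ : Measurable ρ) (hν : ν = volume.withDensity ρ) (hm : 1 / 2 ≤ μ (Set.Iic m)) :
    muckPlus Φ μ ρ m / 8 ≤ osConst Φ μ ν := by
  refine le_iInf fun C => le_iInf fun hC => ?_
  have hνv : ν ≪ volume := hν ▸ withDensity_absolutelyContinuous _ _
  rw [ENNReal.div_le_iff (by norm_num) (by norm_num)]
  refine iSup₂_le fun x hmx => ?_
  -- Truncation makes the test function Lipschitz even where `1 / ρ` is not integrable; monotone
  -- convergence in `N` restores `∫ 1 / ρ`.
  set g : ℕ → ℝ → ℝ≥0∞ := fun N y => min (ρ y)⁻¹ N with hg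
  have hgm : ∀ N, Measurable (g N) := fun N => hρ.inv.min measurable_const
  have hsup : ∫⁻ y in Set.Icc m x, (ρ y)⁻¹ = ⨆ N, ∫⁻ y in Set.Icc m x, g N y := by
    rw [← lintegral_iSup hgm]
    · refine lintegral_congr fun y => ?_
      refine (tendsto_nhds_unique (tendsto_atTop_iSup ?_) ?_).symm
      · exact fun a b hab => min_le_min_left _ (by exact_mod_cast hab)
      · have h1 := (tendsto_const_nhds (x := (ρ y)⁻¹)).min ENNReal.tendsto_nat_nhds_top
        rwa [min_eq_left le_top] at h1
    · exact fun a b hab y => min_le_min_left _ (by exact_mod_cast hab)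
  rw [hsup, ENNReal.mul_iSup]
  refine iSup_le fun N => ?_
  set I := ∫⁻ y in Set.Icc m x, g N y with hI
  have hIt : I ≠ ⊤ := by
    refine ((setLIntegral_mono (g := fun _ => (N : ℝ≥0∞)) measurable_const
      fun y _ => min_le_right _ _).trans_lt ?_).ne
    rw [setLIntegral_const, Real.volume_Icc]
    exact ENNReal.mul_lt_top (by simp) ENNReal.ofReal_lt_top
  rcases eq_or_ne I 0 with hI0 | hI0
  · rw [hI0, mul_zero]
    exact zero_le
  have hIpos : 0 < I.toReal := ENNReal.toReal_pos hI0 hIt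
  have hgt : ∀ y, g N y ≠ ⊤ := fun y => ((min_le_right _ _).trans_lt (by simp)).ne
  set q : ℝ → ℝ := (Set.Icc m x).indicator fun y => (g N y).toReal / I.toReal with hq
  have hqm : Measurable q := ((hgm N).ennreal_toReal.div_const _).indicator measurableSet_Icc
  have hq0 : ∀ y, 0 ≤ q y := Set.indicator_nonneg fun y _ => by positivity
  set K : ℝ≥0 := N / I.toNNReal with hK
  have hKc : (K : ℝ) = N / I.toReal := by simp [hK, ENNReal.toReal]
  have hqK : ∀ y, q y ≤ K := fun y => by
    refine Set.indicator_le' (fun y _ => ?_) (fun _ _ => K.coe_nonneg) y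
    rw [hKc]
    gcongr
    have h1 := ENNReal.toReal_mono (by simp) (min_le_right (ρ y)⁻¹ (N : ℝ≥0∞))
    simpa using h1
  have hqloc : LocallyIntegrable q volume := by
    refine LocallyIntegrable.mono (locallyIntegrable_const (K : ℝ)) hqm.aestronglyMeasurable
      (Filter.Eventually.of_forall fun y => ?_)
    rw [Real.norm_of_nonneg (hq0 y), Real.norm_of_nonneg K.coe_nonneg]
    exact hqK y
  have hqi : ∀ a b, IntervalIntegrable q volume a b := fun a b =>
    (hqloc.integrableOn_isCompact isCompact_uIcc).intervalIntegrable
  set h : ℝ → ℝ := fun y => ∫ s in m..y, q s with hh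
  have hsub : ∀ a b, h b - h a = ∫ s in a..b, q s := fun a b =>
    intervalIntegral.integral_interval_sub_left (hqi _ _) (hqi _ _)
  have hlip : LipschitzWith K h := by
    refine LipschitzWith.of_dist_le_mul fun a b => ?_
    rw [dist_comm, dist_comm a b, Real.dist_eq, hsub, Real.dist_eq, ← Real.norm_eq_abs]
    refine intervalIntegral.norm_integral_le_of_norm_le_const fun y _ => ?_
    rw [Real.norm_of_nonneg (hq0 y)]
    exact hqK y
  have hmono : Monotone h := fun a b hab => by
    rw [← sub_nonneg, hsub]
    exact intervalIntegral.integral_nonneg hab fun y _ => hq0 y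
  have hle : ∀ y, y ≤ m → h y = 0 := fun y hy => by
    simp only [hh]
    rw [intervalIntegral.integral_symm, neg_eq_zero, intervalIntegral.integral_of_le hy,
      integral_Ioc_eq_integral_Ioo]
    refine setIntegral_eq_zero_of_forall_eq_zero fun z hz => Set.indicator_of_notMem ?_ _
    exact fun h => h.1.not_gt hz.2
  have hx1 : h x = 1 := by
    simp only [hh]
    rw [intervalIntegral.integral_of_le hmx.le, ← integral_Icc_eq_integral_Ioc,
      setIntegral_congr_fun measurableSet_Icc (g := fun y => (g N y).toReal / I.toReal)
      fun y hy => Set.indicator_of_mem hy _, integral_div, integral_toReal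
        (hgm N).aemeasurable (Filter.Eventually.of_forall fun y => (hgt y).lt_top), ← hI,
      div_self hIpos.ne']
  have hge : ∀ y, x ≤ y → h y = 1 := fun y hy => by
    have h1 : h y - h x = 0 := by
      rw [hsub, intervalIntegral.integral_of_le hy]
      refine setIntegral_eq_zero_of_forall_eq_zero fun z hz => Set.indicator_of_notMem ?_ _
      exact fun h => h.2.not_gt hz.1
    linarith
  have hh0 : ∀ y, 0 ≤ h y := fun y => by
    rcases le_total y m with hy | hy
    · exact (hle y hy).ge
    · rw [← hle m le_rfl]
      exact hmono hy
  have hh1 : ∀ y, h y ≤ 1 := fun y => by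
    rcases le_total x y with hy | hy
    · exact (hge y hy).le
    · rw [← hx1]
      exact hmono hy
  have hen : energy ν h ≤ I⁻¹ := by
    rw [energy_eq]
    calc ∫⁻ y, ‖fderiv ℝ h y‖ₑ ^ 2 ∂ν = ∫⁻ y, ENNReal.ofReal (q y) ^ 2 ∂ν := by
          refine lintegral_congr_ae ?_
          filter_upwards [hνv (LocallyIntegrable.ae_hasDerivAt_integral hqloc)] with y hy
          have h1 : ‖fderiv ℝ h y‖ = q y := by
            rw [← norm_deriv_eq_norm_fderiv, (hy m).deriv, Real.norm_of_nonneg (hq0 y)]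
          rw [← ofReal_norm, h1]
      _ = ∫⁻ y, ρ y * ENNReal.ofReal (q y) ^ 2 := by
          rw [hν, lintegral_withDensity_eq_lintegral_mul _ hρ (hqm.ennreal_ofReal.pow_const 2)]
          rfl
      _ ≤ ∫⁻ y, (Set.Icc m x).indicator (fun y => g N y * (I⁻¹) ^ 2) y := by
          refine lintegral_mono fun y => ?_
          by_cases hy : y ∈ Set.Icc m x
          · simp only [hq]
            rw [Set.indicator_of_mem hy, Set.indicator_of_mem hy, ENNReal.ofReal_div_of_pos hIpos,
              ENNReal.ofReal_toReal (hgt y), ENNReal.ofReal_toReal hIt, div_eq_mul_inv, mul_pow,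
              ← mul_assoc]
            gcongr
            -- `g N ≤ 1 / ρ` and `ρ * ρ⁻¹ ≤ 1`, also where `ρ` is 0 or `∞`.
            calc ρ y * g N y ^ 2 = ρ y * g N y * g N y := by ring
              _ ≤ ρ y * (ρ y)⁻¹ * g N y := by
                  gcongr
                  exact min_le_left _ _
              _ ≤ 1 * g N y := by
                  gcongr
                  exact ENNReal.mul_inv_le_one _
              _ = g N y := one_mul _
          · simp only [hq]
            rw [Set.indicator_of_notMem hy, Set.indicator_of_notMem hy]
            simp
      _ = I * (I⁻¹) ^ 2 := by
          rw [lintegral_indicator measurableSet_Icc, lintegral_mul_const _ (hgm N)]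
      _ = I⁻¹ := by rw [sq, ← mul_assoc, ENNReal.mul_inv_cancel hI0 hIt, one_mul]
  have hmain := luxInd_le_energy hνv hΦ hC hlip.locallyLipschitz hh0 hh1
    (hm.trans (measure_mono fun y hy => hle y hy)) (measurableSet_Ici (a := x)) fun y hy => hge y hy
  calc luxInd Φ μ (Set.Ici x) * I ≤ 8 * C * I⁻¹ * I := by
        gcongr
        exact hmain.trans (by gcongr)
    _ = C * 8 := by rw [mul_assoc, ENNReal.inv_mul_cancel hI0 hIt, mul_one, mul_comm]

end Line

/-! ### The left half-line by reflection, and the two-sided bound. -/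

section Reflection

variable {Φ : ℝ → ℝ≥0∞} {μ ν : Measure ℝ} {ρ : ℝ → ℝ≥0∞} {m : ℝ}

theorem withDensity_map_neg :
    (volume.withDensity ρ).map (MeasurableEquiv.neg ℝ) = volume.withDensity fun y => ρ (-y) := by
  ext s hs
  have hs' : MeasurableSet (MeasurableEquiv.neg ℝ ⁻¹' s) := (MeasurableEquiv.neg ℝ).measurable hs
  rw [MeasurableEquiv.map_apply, withDensity_apply _ hs', withDensity_apply _ hs,
    ← lintegral_indicator hs', ← lintegral_indicator hs, ← lintegral_neg_eq_self]
  refine lintegral_congr fun y => ?_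
  by_cases hy : y ∈ s
  · rw [Set.indicator_of_mem hy, Set.indicator_of_mem (by simpa using hy)]
  · rw [Set.indicator_of_notMem hy, Set.indicator_of_notMem (by simpa using hy)]

theorem setLIntegral_Icc_neg (g : ℝ → ℝ≥0∞) (a b : ℝ) :
    ∫⁻ y in Set.Icc (-b) (-a), g (-y) = ∫⁻ y in Set.Icc a b, g y := by
  rw [← lintegral_indicator measurableSet_Icc, ← lintegral_indicator measurableSet_Icc,
    ← lintegral_neg_eq_self]
  refine lintegral_congr fun y => ?_
  simp [Set.indicator_apply, and_comm]

theorem muckPlus_map_neg :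
    muckPlus Φ (μ.map (MeasurableEquiv.neg ℝ)) (fun y => ρ (-y)) (-m) = muckMinus Φ μ ρ m := by
  have h1 : ∀ x, luxInd Φ (μ.map (MeasurableEquiv.neg ℝ)) (Set.Ici (-x)) =
      luxInd Φ μ (Set.Iic x) := fun x => by
    rw [luxInd_map]
    congr 1
    ext y
    simp
  rw [muckPlus, muckMinus, ← (Equiv.neg ℝ).iSup_comp]
  refine iSup_congr fun x => ?_
  simp only [Equiv.neg_apply, neg_lt_neg_iff, h1, setLIntegral_Icc_neg (fun y => (ρ y)⁻¹)]

theorem enorm_fderiv_comp_neg (f : ℝ → ℝ) (x : ℝ) :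
    ‖fderiv ℝ (fun y => f (-y)) x‖ₑ = ‖fderiv ℝ f (-x)‖ₑ := by
  rw [← ofReal_norm, ← ofReal_norm, ← norm_deriv_eq_norm_fderiv, ← norm_deriv_eq_norm_fderiv,
    deriv_comp_neg, norm_neg]

theorem energy_map_neg (f : ℝ → ℝ) :
    energy (ν.map (MeasurableEquiv.neg ℝ)) f = energy ν fun y => f (-y) := by
  rw [energy_eq, energy_eq, lintegral_map_equiv]
  simp only [enorm_fderiv_comp_neg, MeasurableEquiv.neg_apply]

theorem osConst_map_neg_le :
    osConst Φ (μ.map (MeasurableEquiv.neg ℝ)) (ν.map (MeasurableEquiv.neg ℝ)) ≤ osConst Φ μ ν := by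
  refine le_iInf fun C => le_iInf fun hC => iInf_le_of_le C (iInf_le _ fun f hf hfi => ?_)
  have h1 := hC (fun y => f (-y)) (hf.comp contDiff_neg)
    ((integrable_map_equiv (MeasurableEquiv.neg ℝ) f).1 hfi)
  rw [luxNorm_map, integral_map_equiv, energy_map_neg]
  exact h1

theorem luxNorm_indicator_Iio_le [IsProbabilityMeasure ν] (hΦ : IsYoung Φ) (hρ : Measurable ρ)
    (hν : ν = volume.withDensity ρ) {B : ℝ≥0} (hB : muckMinus Φ μ ρ m ≤ B)
    {f : ℝ → ℝ} (hf : ContDiff ℝ ∞ f) :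
    luxNorm Φ μ ((Set.Iio m).indicator fun y => (f y - f m) ^ 2) ≤
      4 * B * ∫⁻ y in Set.Iio m, ‖fderiv ℝ f y‖ₑ ^ 2 ∂ν := by
  have : IsProbabilityMeasure (ν.map (MeasurableEquiv.neg ℝ)) :=
    Measure.isProbabilityMeasure_map (MeasurableEquiv.neg ℝ).measurable.aemeasurable
  have h1 := luxNorm_indicator_Ioi_le (μ := μ.map (MeasurableEquiv.neg ℝ))
    (ν := ν.map (MeasurableEquiv.neg ℝ)) (m := -m) hΦ (hρ.comp measurable_neg)
    (by rw [hν]; exact withDensity_map_neg) (muckPlus_map_neg.trans_le hB)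
    (hf.comp contDiff_neg)
  have h2 : MeasurableEquiv.neg ℝ ⁻¹' Set.Ioi (-m) = Set.Iio m := by ext y; simp
  have h3 : ∀ y, ‖fderiv ℝ (f ∘ fun y => -y) y‖ₑ = ‖fderiv ℝ f (-y)‖ₑ := enorm_fderiv_comp_neg f
  rw [luxNorm_map, MeasurableEquiv.restrict_map, lintegral_map_equiv, h2] at h1
  simp only [h3, MeasurableEquiv.neg_apply, neg_neg] at h1
  refine le_of_eq_of_le ?_ h1
  congr 1
  funext y
  simp [Set.indicator_apply]

theorem muckMinus_div_le_osConst [IsProbabilityMeasure μ] [IsProbabilityMeasure ν]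
    (hΦ : IsYoung Φ) (hρ : Measurable ρ) (hν : ν = volume.withDensity ρ)
    (hm : 1 / 2 ≤ μ (Set.Ici m)) : muckMinus Φ μ ρ m / 8 ≤ osConst Φ μ ν := by
  have : IsProbabilityMeasure (μ.map (MeasurableEquiv.neg ℝ)) :=
    Measure.isProbabilityMeasure_map (MeasurableEquiv.neg ℝ).measurable.aemeasurable
  have : IsProbabilityMeasure (ν.map (MeasurableEquiv.neg ℝ)) :=
    Measure.isProbabilityMeasure_map (MeasurableEquiv.neg ℝ).measurable.aemeasurable
  refine le_trans ?_ (osConst_map_neg_le (Φ := Φ) (μ := μ) (ν := ν))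
  rw [← muckPlus_map_neg]
  refine muckPlus_div_le_osConst hΦ (hρ.comp measurable_neg)
    (by rw [hν]; exact withDensity_map_neg) ?_
  rw [MeasurableEquiv.map_apply]
  refine hm.trans (measure_mono fun y hy => ?_)
  simpa using hy

theorem osConst_le_muck [IsProbabilityMeasure μ] [IsProbabilityMeasure ν] (hΦ : IsYoung Φ)
    {k : ℝ≥0} (hk : MeanSqBound Φ μ k) (hρ : Measurable ρ) (hν : ν = volume.withDensity ρ) :
    osConst Φ μ ν ≤ 8 * (1 + (k : ℝ≥0∞)) * max (muckPlus Φ μ ρ m) (muckMinus Φ μ ρ m) := by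
  rcases eq_or_ne (max (muckPlus Φ μ ρ m) (muckMinus Φ μ ρ m)) ⊤ with htop | htop
  · rw [htop, ENNReal.mul_top (by simp)]
    exact le_top
  obtain ⟨B, hB⟩ : ∃ B : ℝ≥0, (B : ℝ≥0∞) = max (muckPlus Φ μ ρ m) (muckMinus Φ μ ρ m) :=
    ⟨_, ENNReal.coe_toNNReal htop⟩
  rw [← hB]
  refine osConst_le_of_forall hΦ hk fun f hf => ⟨f m, ?_⟩
  have h1 := luxNorm_indicator_Ioi_le (μ := μ) (m := m) hΦ hρ hν ((le_max_left _ _).trans hB.ge) hf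
  have h2 := luxNorm_indicator_Iio_le (μ := μ) (m := m) hΦ hρ hν ((le_max_right _ _).trans hB.ge) hf
  have hdisj : Disjoint (Set.Ioi m) (Set.Iio m) := by
    rw [Set.disjoint_left]
    exact fun y hy hy' => lt_asymm (a := m) (b := y) hy hy'
  have hcont := hf.continuous
  calc luxNorm Φ μ (fun y => (f y - f m) ^ 2)
      = luxNorm Φ μ (fun y => (Set.Ioi m).indicator (fun y => (f y - f m) ^ 2) y +
          (Set.Iio m).indicator (fun y => (f y - f m) ^ 2) y) := by
        congr 1
        funext y
        rcases lt_trichotomy y m with h | h | h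
        · simp [h, h.le]
        · simp [h]
        · simp [h, h.le]
    _ ≤ luxNorm Φ μ ((Set.Ioi m).indicator fun y => (f y - f m) ^ 2) +
          luxNorm Φ μ ((Set.Iio m).indicator fun y => (f y - f m) ^ 2) :=
        luxNorm_add_le hΦ (Measurable.indicator (by fun_prop) measurableSet_Ioi)
    _ ≤ 4 * B * ∫⁻ y in Set.Ioi m, ‖fderiv ℝ f y‖ₑ ^ 2 ∂ν +
          4 * B * ∫⁻ y in Set.Iio m, ‖fderiv ℝ f y‖ₑ ^ 2 ∂ν := add_le_add h1 h2
    _ = 4 * B * ∫⁻ y in Set.Ioi m ∪ Set.Iio m, ‖fderiv ℝ f y‖ₑ ^ 2 ∂ν := by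
        rw [lintegral_union measurableSet_Iio hdisj, mul_add]
    _ ≤ 4 * B * energy ν f := by
        rw [energy_eq]
        gcongr
        exact Measure.restrict_le_self

end Reflection

theorem mainTheorem1 (Φ : ℝ → ℝ≥0∞) (hΦ : IsYoung Φ) (k : ℝ≥0) (hk : 0 < k) :
    (∀ (n : ℕ) (μ ν : Measure (EuclideanSpace ℝ (Fin n)))
        [IsProbabilityMeasure μ] [IsProbabilityMeasure ν],
      μ ≪ volume → ν ≪ volume → MeanSqBound Φ μ k →
      capConst Φ μ ν / 8 ≤ osConst Φ μ ν ∧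
        osConst Φ μ ν ≤ 8 * (1 + (k : ℝ≥0∞)) * capConst Φ μ ν) ∧
    (∀ (μ ν : Measure ℝ) [IsProbabilityMeasure μ] [IsProbabilityMeasure ν]
        (ρ : ℝ → ℝ≥0∞) (m : ℝ),
      μ ≪ volume → Measurable ρ → ν = volume.withDensity ρ → MeanSqBound Φ μ k →
      IsMedian μ m →
      max (muckPlus Φ μ ρ m) (muckMinus Φ μ ρ m) / 8 ≤ osConst Φ μ ν ∧
        osConst Φ μ ν ≤
          8 * (1 + (k : ℝ≥0∞)) * max (muckPlus Φ μ ρ m) (muckMinus Φ μ ρ m)) := by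
  refine ⟨fun n μ ν _ _ hμ hν hmk => ⟨capConst_div_le_osConst hν hΦ, osConst_le_capConst hμ hΦ hmk⟩,
    fun μ ν _ _ ρ m _ hρ hν hmk hm => ⟨?_, osConst_le_muck hΦ hmk hρ hν⟩⟩
  rcases max_choice (muckPlus Φ μ ρ m) (muckMinus Φ μ ρ m) with h | h <;> rw [h]
  · exact muckPlus_div_le_osConst hΦ hρ hν hm.1
  · exact muckMinus_div_le_osConst hΦ hρ hν hm.2
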